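/- **Proposition 2.3 (Example 3, $k$-Hessian).** Let $N,k$ be integers and $m$ a real number with $1\le k<\min\{m,N/2\}$. For a radially symmetric function $u=u(r)$ on a ball of $\mathbb R^N$ put $$S_k(D^2u)=\frac1k\binom{N-1}{k-1}r^{-(N-1)}\Big[r^{N-k}(u')^k\Big]',\qquad c_{N,k}=k\binom{N-1}{k-1}^{-1}.$$ For $r_0>0$ and $b\ge 0$, a radial solution of problem $(P_b)$ on $B_{r_0}$ is a function $u\in C^2(0,r_0)\cap C[0,r_0)$ with $$c_{N,k}S_k(D^2u)=\frac1{u^m},\quad u>0\quad\text{for } 0<r<r_0,\qquad u(0)=b.$$ There exists $r_0>0$ such that the following hold. (i) Problem $(P_0)$ has a unique (strictly) increasing radial solution $u^*$ on $B_{r_0}$, and for $0\le r<r_0$ $$u^*(r)=\left[\frac{m+k}{Nk+m(N-2k)}\Big(\frac{m+k}{2k}\Big)^k\right]^{\frac1{m+k}}r^{\frac{2k}{m+k}}.$$ (ii) For every $a\in(0,1)$ problem $(P_a)$ has a radial solution on $B_{r_0}$, and exactly one which is increasing. For each $a\in(0,1)$ let $u(\cdot,a)$ be a radial solution of $(P_a)$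 on $B_{r_0}$. Then: (ii1) $u(\cdot,a)\to u^*$ in $C^2_{\rm loc}(0,r_0)\cap C_{\rm loc}[0,r_0)$ as $a\to0^+$. (ii2) Let $$q_c=\frac12+\frac{(k+1)^2}{2\big(\sqrt{Nk+N-2k}-\sqrt2\big)^2-2(k+1)^2},$$ with the convention $q_c=+\infty$ if the denominator is not positive. If $\frac m{m-k}<q_c$, then for every $\rho\in(0,r_0)$ the number of zeros of $u(\cdot,a)-u^*$ in $(0,\rho)$ (an element of $\mathbb N\cup\{\infty\}$) tends to $\infty$ as $a\to0^+$. -/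

import Mathlib

open Set Filter Topology

/-- The `k`-Hessian operator `S_k(D²u)` of a radially symmetric function `u = u(r)` on `ℝ^N`,
`S_k(D²u) = (1/k) * C(N-1,k-1) * r^{-(N-1)} * [r^{N-k} (u')^k]'`. -/
noncomputable def radialKHessian (N k : ℕ) (u : ℝ → ℝ) (r : ℝ) : ℝ :=
  1 / (k : ℝ) * ((N - 1).choose (k - 1) : ℝ) * (r ^ (N - 1))⁻¹ *
    deriv (fun s : ℝ => s ^ (N - k) * (deriv u s) ^ k) r

/-- The normalising constant `c_{N,k} = k * C(N-1,k-1)⁻¹`. -/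
noncomputable def kHessianConst (N k : ℕ) : ℝ :=
  (k : ℝ) * ((N - 1).choose (k - 1) : ℝ)⁻¹

/-- `u` is (the profile of) a radially symmetric solution, of class `C²(0,r₀) ∩ C[0,r₀)`, of
`c_{N,k} S_k(D²u) = u^{-m}`, `u > 0` for `0 < |x| < r₀`, with `u(0) = b`.
For `b = 0` this is the rupture problem, for `b > 0` the solutions are the regular ones. -/
structure IsRadialKHessianSol (N k : ℕ) (m r₀ b : ℝ) (u : ℝ → ℝ) : Prop where
  contDiffOn : ContDiffOn ℝ 2 u (Ioo 0 r₀)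
  continuousOn : ContinuousOn u (Ico 0 r₀)
  pos : ∀ r ∈ Ioo 0 r₀, 0 < u r
  equation : ∀ r ∈ Ioo 0 r₀, kHessianConst N k * radialKHessian N k u r = 1 / (u r) ^ m
  value_zero : u 0 = b

/-- The explicit function
`[(m+k)/(Nk + m(N-2k)) * ((m+k)/(2k))^k]^{1/(m+k)} * r^{2k/(m+k)}`. -/
noncomputable def kHessianRupture (N k : ℕ) (m r : ℝ) : ℝ :=
  ((m + k) / ((N : ℝ) * k + m * ((N : ℝ) - 2 * k)) * ((m + k) / (2 * k)) ^ k) ^ (1 / (m + k)) *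
    r ^ (2 * (k : ℝ) / (m + k))

/-- The denominator `2(√(Nk+N-2k) - √2)² - 2(k+1)²` in the critical exponent. -/
noncomputable def kHessianQcDenom (N k : ℕ) : ℝ :=
  2 * (√((N : ℝ) * k + N - 2 * k) - √2) ^ 2 - 2 * ((k : ℝ) + 1) ^ 2

open Classical in
/-- The critical exponent `q_c = 1/2 + (k+1)² / (2(√(Nk+N-2k) - √2)² - 2(k+1)²)`,
understood as `+∞` when the denominator is not positive. -/
noncomputable def kHessianQc (N k : ℕ) : EReal :=
  if 0 < kHessianQcDenom N k then
    ((1 / 2 + ((k : ℝ) + 1) ^ 2 / kHessianQcDenom N k : ℝ) : EReal)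
  else ⊤

/-- The zero number of `h` on `I`, an element of `ℕ ∪ {∞}`. -/
noncomputable def zeroNumber (I : Set ℝ) (h : ℝ → ℝ) : ℕ∞ :=
  {r ∈ I | h r = 0}.encard

/-- Convergence `U a → v` in `C^j_loc(S)` as `a → 0⁺`: all derivatives up to order `j` converge
uniformly on the compact subsets of `S`. For `j ≥ 1` it is only used with `S` open. -/
def TendstoCLoc (j : ℕ) (S : Set ℝ) (U : ℝ → ℝ → ℝ) (v : ℝ → ℝ) : Prop :=
  ∀ i ≤ j, ∀ K ⊆ S, IsCompact K →
    TendstoUniformlyOn (fun a => iteratedDeriv i (U a)) (iteratedDeriv i v) (𝓝[>] 0) K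

/-!
Put `θ = 2k/(m+k)` and `A = N - mθ`. In divergence form the equation says that the flux
`w = r^{N-k} (u')^k` has derivative `r^{N-1} u^{-m}`. As `N > 2k`, a flux that did not vanish at the
origin would make `u` unbounded there, and on a ball of radius `2N` a decreasing solution with
`u(0) < 1` would become negative; so every solution in question is increasing
(`IsRadialKHessianSol.radialFlow`).

Dividing `u` and `w` by the corresponding quantities of the power solution `u^* = C r^θ` gives
ratios `X` and `P`, which solve the autonomous system
`r X' = θ (P^{1/k} - X)`, `r P' = A (X^{-m} - P)` with equilibrium `(1, 1)`. The function
`E = θ ∫₁^P (q^{1/k} - 1) dq + A ∫₁^X (1 - x^{-m}) dx` satisfies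
`r E' = -θA ((P^{1/k} - 1)(P - 1) + (1 - X^{-m})(X - 1)) ≤ -min(A, θ) E`, the inequality because a
convex function with minimum `0` at `1` lies below `G'(x) (x - 1)`. Hence `r^c E` is antitone
(`RadialFlow.antitoneOn_energy`). Read towards infinity this gives `X, P → 1` for every global
solution (`RadialFlow.ratios_tendsto_one`). Read towards the origin, where `E` is bounded if
`u(0) = 0`, it gives `E = 0`, i.e. uniqueness of the rupture solution
(`RadialFlow.eqOn_kHessianRupture`).

For `u(0) = a > 0` existence and uniqueness come from Picard iteration for an integral operator of
Volterra type (`exists_radialFlow`, `RadialFlow.eqOn_of_pos`). All these solutions are rescalings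
`a V(r / a^{1/θ})` of one global solution `V`, so convergence as `a → 0⁺` is the asymptotics of `V`
at infinity, and the number of intersections with `u^*` diverges once `V - u^*` has infinitely many
zeros. The condition `m/(m-k) < q_c` says exactly that the linearisation at `(1, 1)` has non-real
eigenvalues (`discriminant_neg_of_lt_qc`); then `arctan ((P - 1)/(X - 1))` would decrease without
bound along an interval `[s, ∞)` free of zeros (`RadialFlow.exists_solRatio_eq_one`).
-/

/-! ### Constants of the rupture solution -/

/-- The homogeneity exponent `θ = 2k/(m+k)` of the rupture solution. -/
noncomputable def ruptureExp (k : ℕ) (m : ℝ) : ℝ := 2 * (k : ℝ) / (m + k)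

/-- The exponent `A = N - mθ`: the flux `r^{N-k} (u')^k` of the rupture solution is a multiple of
`r^A`. -/
noncomputable def fluxExp (N k : ℕ) (m : ℝ) : ℝ := N - m * ruptureExp k m

/-- The coefficient `C` of the rupture solution `C r^θ`. -/
noncomputable def ruptureCoeff (N k : ℕ) (m : ℝ) : ℝ :=
  ((m + k) / ((N : ℝ) * k + m * ((N : ℝ) - 2 * k)) * ((m + k) / (2 * k)) ^ k) ^ (1 / (m + k))

lemma kHessianRupture_eq (N k : ℕ) (m r : ℝ) :
    kHessianRupture N k m r = ruptureCoeff N k m * r ^ ruptureExp k m := rfl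

section Constants

variable {N k : ℕ} {m : ℝ}

lemma ruptureExp_pos (hk : 1 ≤ k) (hm : (k : ℝ) < m) : 0 < ruptureExp k m := by
  have : (0 : ℝ) < k := by exact_mod_cast hk
  unfold ruptureExp
  have : 0 < m + k := by linarith
  positivity

lemma ruptureExp_mul (hk : 1 ≤ k) (hm : (k : ℝ) < m) : ruptureExp k m * (m + k) = 2 * k := by
  have : (0 : ℝ) < k := by exact_mod_cast hk
  unfold ruptureExp
  have : m + k ≠ 0 := by linarith
  field_simp

lemma fluxExp_eq (hk : 1 ≤ k) (hm : (k : ℝ) < m) :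
    fluxExp N k m = N - 2 * k + k * ruptureExp k m := by
  have := ruptureExp_mul hk hm
  unfold fluxExp
  linarith

lemma fluxExp_pos (hk : 1 ≤ k) (hm : (k : ℝ) < m) (hN : 2 * (k : ℝ) < N) :
    0 < fluxExp N k m := by
  have : (0 : ℝ) < k := by exact_mod_cast hk
  have h2 := ruptureExp_pos hk hm
  rw [fluxExp_eq hk hm]
  nlinarith

lemma ruptureCoeff_base_eq (hk : 1 ≤ k) (hm : (k : ℝ) < m) :
    (m + k) / ((N : ℝ) * k + m * ((N : ℝ) - 2 * k)) * ((m + k) / (2 * k)) ^ k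
      = (fluxExp N k m * ruptureExp k m ^ k)⁻¹ := by
  have h0 : (0 : ℝ) < k := by exact_mod_cast hk
  have h1 : 0 < m + k := by linarith
  have h3 : fluxExp N k m = ((N : ℝ) * k + m * ((N : ℝ) - 2 * k)) / (m + k) := by
    unfold fluxExp ruptureExp
    field_simp
    ring
  rw [h3, mul_inv, inv_div, ← inv_pow]
  unfold ruptureExp
  rw [inv_div]

lemma ruptureCoeff_pos (hk : 1 ≤ k) (hm : (k : ℝ) < m) (hN : 2 * (k : ℝ) < N) :
    0 < ruptureCoeff N k m := by
  unfold ruptureCoeff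
  rw [ruptureCoeff_base_eq hk hm]
  have := fluxExp_pos hk hm hN
  have := ruptureExp_pos hk hm
  positivity

lemma ruptureCoeff_rpow (hk : 1 ≤ k) (hm : (k : ℝ) < m) (hN : 2 * (k : ℝ) < N) :
    fluxExp N k m * ruptureExp k m ^ k * ruptureCoeff N k m ^ (m + k) = 1 := by
  have h0 : (0 : ℝ) < k := by exact_mod_cast hk
  have h1 : m + k ≠ 0 := by linarith
  have := fluxExp_pos hk hm hN
  have := ruptureExp_pos hk hm
  unfold ruptureCoeff
  rw [ruptureCoeff_base_eq hk hm, one_div, Real.rpow_inv_rpow (by positivity) h1]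
  exact mul_inv_cancel₀ (by positivity)

lemma ruptureCoeff_neg_rpow (hk : 1 ≤ k) (hm : (k : ℝ) < m) (hN : 2 * (k : ℝ) < N) :
    ruptureCoeff N k m ^ (-m) = fluxExp N k m * (ruptureCoeff N k m * ruptureExp k m) ^ k := by
  have hC := ruptureCoeff_pos hk hm hN
  have h := ruptureCoeff_rpow hk hm hN
  rw [Real.rpow_add hC, Real.rpow_natCast] at h
  rw [Real.rpow_neg hC.le]
  exact inv_eq_of_mul_eq_one_right (by rw [mul_pow]; linarith)

end Constants

/-! ### Convex primitives -/

section ConvexPrimitive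

variable {G g : ℝ → ℝ}

/-- The tangent-line estimates for a convex function with a critical point at `1`. -/
lemma convexPrimitive_bounds (hG : ∀ x, 0 < x → HasDerivAt G (g x) x) (hg : StrictMonoOn g (Ioi 0))
    (hG1 : G 1 = 0) (hg1 : g 1 = 0) {x : ℝ} (hx : 0 < x) :
    0 ≤ G x ∧ G x ≤ g x * (x - 1) ∧ (x ≠ 1 → 0 < G x) := by
  rcases lt_trichotomy x 1 with h | h | h
  · obtain ⟨c, hc, hc'⟩ := exists_hasDerivAt_eq_slope G g h
      (fun y hy => (hG y (hx.trans_le hy.1)).continuousAt.continuousWithinAt)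
      (fun y hy => hG y (hx.trans hy.1))
    have h1 : g c < 0 := hg1 ▸ hg (mem_Ioi.2 (hx.trans hc.1)) (mem_Ioi.2 one_pos) hc.2
    have h2 : g x < g c := hg (mem_Ioi.2 hx) (mem_Ioi.2 (hx.trans hc.1)) hc.1
    have h3 : G x = g c * (x - 1) := by
      rw [hc', hG1]
      field_simp [(sub_pos.2 h).ne']
      ring
    have h4 : 0 < G x := by rw [h3]; nlinarith
    exact ⟨h4.le, by rw [h3]; nlinarith, fun _ => h4⟩
  · subst h
    simp [hG1, hg1]
  · obtain ⟨c, hc, hc'⟩ := exists_hasDerivAt_eq_slope G g h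
      (fun y hy => (hG y (one_pos.trans_le hy.1)).continuousAt.continuousWithinAt)
      (fun y hy => hG y (one_pos.trans hy.1))
    have h1 : 0 < g c := hg1 ▸ hg (mem_Ioi.2 one_pos) (mem_Ioi.2 (one_pos.trans hc.1)) hc.1
    have h2 : g c < g x := hg (mem_Ioi.2 (one_pos.trans hc.1)) (mem_Ioi.2 hx) hc.2
    have h3 : G x = g c * (x - 1) := by
      rw [hc', hG1]
      field_simp [(sub_pos.2 h).ne']
      ring
    have h4 : 0 < G x := by rw [h3]; nlinarith
    exact ⟨h4.le, by rw [h3]; nlinarith, fun _ => h4⟩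

/-- Sublevel sets of a strictly convex function shrink to its minimum point. -/
lemma tendsto_one_of_convexPrimitive (hG : ∀ x, 0 < x → HasDerivAt G (g x) x)
    (hg : StrictMonoOn g (Ioi 0)) (hG1 : G 1 = 0) (hg1 : g 1 = 0) {ι : Type*} {l : Filter ι}
    {f : ι → ℝ} (hf : ∀ᶠ i in l, 0 < f i) (h : Tendsto (fun i => G (f i)) l (𝓝 0)) :
    Tendsto f l (𝓝 1) := by
  have hmono : ∀ x y, 1 ≤ x → x ≤ y → G x ≤ G y := by
    intro x y hx hxy
    refine monotoneOn_of_deriv_nonneg (convex_Ici 1)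
      (fun z hz => (hG z (one_pos.trans_le hz)).continuousAt.continuousWithinAt) ?_ ?_
      (mem_Ici.2 hx) (mem_Ici.2 (hx.trans hxy)) hxy
    · intro z hz
      rw [interior_Ici] at hz
      exact (hG z (one_pos.trans hz)).differentiableAt.differentiableWithinAt
    · intro z hz
      rw [interior_Ici] at hz
      rw [(hG z (one_pos.trans hz)).deriv, ← hg1]
      exact (hg (mem_Ioi.2 one_pos) (mem_Ioi.2 (one_pos.trans hz)) hz).le
  have hanti : ∀ x y, 0 < x → x ≤ y → y ≤ 1 → G y ≤ G x := by
    intro x y hx hxy hy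
    refine antitoneOn_of_deriv_nonpos (convex_Ioc 0 1)
      (fun z hz => (hG z hz.1).continuousAt.continuousWithinAt) ?_ ?_
      ⟨hx, hxy.trans hy⟩ ⟨hx.trans_le hxy, hy⟩ hxy
    · intro z hz
      rw [interior_Ioc] at hz
      exact (hG z hz.1).differentiableAt.differentiableWithinAt
    · intro z hz
      rw [interior_Ioc] at hz
      rw [(hG z hz.1).deriv, ← hg1]
      exact (hg (mem_Ioi.2 hz.1) (mem_Ioi.2 one_pos) hz.2).le
  rw [tendsto_order]
  constructor
  · intro a ha
    set b := max a (1 / 2) with hb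
    have hb0 : 0 < b := lt_of_lt_of_le (by norm_num) (le_max_right _ _)
    have hb1 : b < 1 := max_lt ha (by norm_num)
    have h1 := (convexPrimitive_bounds hG hg hG1 hg1 hb0).2.2 hb1.ne
    filter_upwards [hf, h.eventually (gt_mem_nhds h1)] with i hi hi'
    by_contra hcon
    exact absurd (hanti _ _ hi ((not_lt.1 hcon).trans (le_max_left _ _)) hb1.le) (not_le.2 hi')
  · intro a ha
    have h1 := (convexPrimitive_bounds hG hg hG1 hg1 (one_pos.trans ha)).2.2 ha.ne'
    filter_upwards [hf, h.eventually (gt_mem_nhds h1)] with i hi hi'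
    by_contra hcon
    exact absurd (hmono _ _ ha.le (not_lt.1 hcon)) (not_le.2 hi')

end ConvexPrimitive

/-- The function `x ↦ (x^{p+1} - 1)/(p+1) - (x - 1)`, the primitive of `x^p - 1` vanishing
at `1`. -/
noncomputable def powPrimitive (p x : ℝ) : ℝ := (x ^ (p + 1) - 1) / (p + 1) - (x - 1)

lemma powPrimitive_one (p : ℝ) : powPrimitive p 1 = 0 := by simp [powPrimitive]

lemma hasDerivAt_powPrimitive {p : ℝ} (hp : p + 1 ≠ 0) {x : ℝ} (hx : 0 < x) :
    HasDerivAt (powPrimitive p) (x ^ p - 1) x := by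
  have h := (((Real.hasDerivAt_rpow_const (p := p + 1) (Or.inl hx.ne')).sub_const 1).div_const
    (p + 1)).sub ((hasDerivAt_id x).sub_const 1)
  refine h.congr_deriv ?_
  rw [mul_div_cancel_left₀ _ hp]
  simp

lemma strictMonoOn_rpow_sub_one {p : ℝ} (hp : 0 < p) :
    StrictMonoOn (fun x : ℝ => x ^ p - 1) (Ioi 0) := fun _ hx _ _ hxy =>
  sub_lt_sub_right (Real.rpow_lt_rpow (le_of_lt hx) hxy hp) 1

lemma strictMonoOn_one_sub_rpow {p : ℝ} (hp : p < 0) :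
    StrictMonoOn (fun x : ℝ => -(x ^ p - 1)) (Ioi 0) := fun _ hx _ _ hxy =>
  neg_lt_neg (sub_lt_sub_right (Real.rpow_lt_rpow_of_neg hx hxy hp) 1)

/-! ### Increasing radial solutions in first-order form -/

/-- An increasing solution of the radial equation on `(0, R)` in divergence form:
the flux `r^{N-k} (u')^k` has derivative `r^{N-1} u^{-m}` and vanishes at the origin. -/
structure RadialFlow (N k : ℕ) (m R : ℝ) (u u' : ℝ → ℝ) : Prop where
  pos : ∀ r ∈ Ioo 0 R, 0 < u r
  deriv_pos : ∀ r ∈ Ioo 0 R, 0 < u' r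
  hasDerivAt : ∀ r ∈ Ioo 0 R, HasDerivAt u (u' r) r
  flux : ∀ r ∈ Ioo 0 R,
    HasDerivAt (fun s => s ^ (N - k) * u' s ^ k) (r ^ (N - 1) * u r ^ (-m)) r
  flux_zero : Tendsto (fun s => s ^ (N - k) * u' s ^ k) (𝓝[>] 0) (𝓝 0)

lemma contDiffOn_succ_of_hasDerivAt {f f' : ℝ → ℝ} {s : Set ℝ} (hs : IsOpen s) {n : ℕ}
    (hf : ∀ x ∈ s, HasDerivAt f (f' x) x) (hf' : ContDiffOn ℝ n f' s) :
    ContDiffOn ℝ (n + 1) f s := by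
  rw [contDiffOn_succ_iff_deriv_of_isOpen hs]
  refine ⟨fun x hx => (hf x hx).differentiableAt.differentiableWithinAt, by simp, ?_⟩
  exact hf'.congr fun x hx => (hf x hx).deriv

section Conversion

variable {N k : ℕ} {m R b : ℝ} {u u' : ℝ → ℝ}

lemma kHessianConst_mul_radialKHessian (hk : 1 ≤ k) (hN : 2 * (k : ℝ) < N) (r : ℝ) :
    kHessianConst N k * radialKHessian N k u r =
      (r ^ (N - 1))⁻¹ * deriv (fun s : ℝ => s ^ (N - k) * (deriv u s) ^ k) r := by
  have hN' : 2 * k < N := by exact_mod_cast hN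
  have h1 : ((N - 1).choose (k - 1) : ℝ) ≠ 0 := by
    exact_mod_cast (Nat.choose_pos (by omega)).ne'
  have h2 : (k : ℝ) ≠ 0 := by exact_mod_cast (by omega : k ≠ 0)
  unfold kHessianConst radialKHessian
  field_simp

lemma RadialFlow.isRadialKHessianSol (hk : 1 ≤ k) (hN : 2 * (k : ℝ) < N)
    (h : RadialFlow N k m R u u') (hu : ContinuousOn u (Ico 0 R)) (h0 : u 0 = b) :
    IsRadialKHessianSol N k m R b u := by
  have hk0 : (k : ℝ) ≠ 0 := by exact_mod_cast (by omega : k ≠ 0)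
  have hcu : ContinuousOn u (Ioo 0 R) := hu.mono Ioo_subset_Ico_self
  have hw : ContDiffOn ℝ 1 (fun s => s ^ (N - k) * u' s ^ k) (Ioo 0 R) := by
    have := contDiffOn_succ_of_hasDerivAt (n := 0) isOpen_Ioo h.flux ?_
    · simpa using this
    · rw [Nat.cast_zero, contDiffOn_zero]
      exact (continuousOn_pow _).mul (hcu.rpow_const fun x hx => Or.inl (h.pos x hx).ne')
  have hu' : ContDiffOn ℝ 1 u' (Ioo 0 R) := by
    have h1 : ContDiffOn ℝ 1 (fun s => ((s ^ (N - k) * u' s ^ k) / s ^ (N - k)) ^ (k : ℝ)⁻¹)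
        (Ioo 0 R) := by
      refine ContDiffOn.rpow_const_of_ne (hw.div (contDiffOn_id.pow _) ?_) ?_
      · intro x hx
        exact (pow_pos hx.1 _).ne'
      · intro x hx
        have := h.deriv_pos x hx
        have := hx.1
        positivity
    refine h1.congr fun x hx => ?_
    have h2 := h.deriv_pos x hx
    have h3 : x ^ (N - k) ≠ 0 := (pow_pos hx.1 _).ne'
    rw [mul_div_cancel_left₀ _ h3, Real.pow_rpow_inv_natCast h2.le (by omega)]
  refine ⟨?_, hu, h.pos, ?_, h0⟩
  · have := contDiffOn_succ_of_hasDerivAt (n := 1) isOpen_Ioo h.hasDerivAt (by exact_mod_cast hu')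
    convert this using 1
    norm_num
  · intro r hr
    rw [kHessianConst_mul_radialKHessian hk hN]
    have h1 : (fun s : ℝ => s ^ (N - k) * (deriv u s) ^ k) =ᶠ[𝓝 r]
        fun s => s ^ (N - k) * u' s ^ k := by
      filter_upwards [isOpen_Ioo.mem_nhds hr] with s hs
      rw [(h.hasDerivAt s hs).deriv]
    rw [h1.deriv_eq, (h.flux r hr).deriv, Real.rpow_neg (h.pos r hr).le, one_div,
      inv_mul_cancel_left₀ (pow_pos hr.1 _).ne']

lemma IsRadialKHessianSol.hasDerivAt (h : IsRadialKHessianSol N k m R b u) :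
    ∀ r ∈ Ioo 0 R, HasDerivAt u (deriv u r) r := fun _ hr =>
  ((h.contDiffOn.differentiableOn (by norm_num)).differentiableAt
    (isOpen_Ioo.mem_nhds hr)).hasDerivAt

lemma IsRadialKHessianSol.contDiffOn_deriv (h : IsRadialKHessianSol N k m R b u) :
    ContDiffOn ℝ 1 (deriv u) (Ioo 0 R) :=
  h.contDiffOn.deriv_of_isOpen isOpen_Ioo (by norm_num)

lemma IsRadialKHessianSol.flux (hk : 1 ≤ k) (hN : 2 * (k : ℝ) < N)
    (h : IsRadialKHessianSol N k m R b u) :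
    ∀ r ∈ Ioo 0 R,
      HasDerivAt (fun s => s ^ (N - k) * deriv u s ^ k) (r ^ (N - 1) * u r ^ (-m)) r := by
  intro r hr
  have hd : DifferentiableAt ℝ (fun s => s ^ (N - k) * deriv u s ^ k) r := by
    have := (h.contDiffOn_deriv.differentiableOn (by norm_num)).differentiableAt
      (isOpen_Ioo.mem_nhds hr)
    fun_prop
  have he := h.equation r hr
  rw [kHessianConst_mul_radialKHessian hk hN, inv_mul_eq_iff_eq_mul₀ (pow_pos hr.1 _).ne'] at he
  rw [Real.rpow_neg (h.pos r hr).le, ← one_div, ← he]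
  exact hd.hasDerivAt

/-- A derivative below `-c/r` forces divergence at the origin. -/
lemma tendsto_atTop_of_deriv_le_neg_div {f f' : ℝ → ℝ} {δ c : ℝ} (hδ : 0 < δ) (hc : 0 < c)
    (hf : ∀ r ∈ Ioo 0 δ, HasDerivAt f (f' r) r) (hf' : ∀ r ∈ Ioo 0 δ, f' r ≤ -(c / r)) :
    Tendsto f (𝓝[>] 0) atTop := by
  have hd : ∀ r ∈ Ioo 0 δ, HasDerivAt (fun r => f r + c * Real.log r) (f' r + c * r⁻¹) r :=
    fun r hr => (hf r hr).add ((Real.hasDerivAt_log hr.1.ne').const_mul c)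
  have hanti : AntitoneOn (fun r => f r + c * Real.log r) (Ioo 0 δ) := by
    refine antitoneOn_of_deriv_nonpos (convex_Ioo 0 δ)
      (fun r hr => (hd r hr).continuousAt.continuousWithinAt) ?_ ?_
    · rw [interior_Ioo]
      exact fun r hr => (hd r hr).differentiableAt.differentiableWithinAt
    · rw [interior_Ioo]
      intro r hr
      rw [(hd r hr).deriv]
      have := hf' r hr
      rw [div_eq_mul_inv] at this
      linarith
  have hlog : Tendsto (fun r => f (δ / 2) + c * Real.log (δ / 2) + c * (-Real.log r)) (𝓝[>] 0)
      atTop :=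
    tendsto_atTop_add_const_left _ _
      ((tendsto_neg_atBot_atTop.comp Real.tendsto_log_nhdsGT_zero).const_mul_atTop hc)
  refine tendsto_atTop_mono' _ ?_ hlog
  filter_upwards [Ioo_mem_nhdsGT (half_pos hδ)] with r hr
  have := hanti ⟨hr.1, by linarith [hr.2]⟩ ⟨half_pos hδ, by linarith⟩ hr.2.le
  simp only at this
  linarith

/-- Since `N - k ≥ k`, a flux bounded away from zero gives `|u'| ≥ c / r` near the origin. -/
lemma div_le_abs_of_le_abs_flux (hk : 1 ≤ k) (hN : 2 * (k : ℝ) < N) {κ r y : ℝ} (hκ : 0 ≤ κ)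
    (hr : 0 < r) (hr1 : r ≤ 1) (h : κ ≤ |r ^ (N - k) * y ^ k|) : κ ^ (k : ℝ)⁻¹ / r ≤ |y| := by
  have hN' : 2 * k < N := by exact_mod_cast hN
  have h1 : r ^ (N - k) ≤ r ^ k := pow_le_pow_of_le_one hr.le hr1 (by omega)
  refine le_of_pow_le_pow_left₀ (by omega : k ≠ 0) (abs_nonneg y) ?_
  rw [div_pow, Real.rpow_inv_natCast_pow hκ (by omega), div_le_iff₀ (by positivity), ← abs_pow]
  rw [abs_mul, abs_of_pos (pow_pos hr _)] at h
  nlinarith [abs_nonneg (y ^ k)]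

lemma IsRadialKHessianSol.tendsto_nhds (h : IsRadialKHessianSol N k m R b u) (hR : 0 < R) :
    Tendsto u (𝓝[>] 0) (𝓝 b) := by
  have := (h.continuousOn 0 ⟨le_rfl, hR⟩).tendsto
  rw [h.value_zero] at this
  refine this.mono_left ?_
  rw [← nhdsWithin_Ioo_eq_nhdsGT hR]
  exact nhdsWithin_mono _ Ioo_subset_Ico_self

lemma IsRadialKHessianSol.strictMonoOn_flux (hk : 1 ≤ k) (hN : 2 * (k : ℝ) < N)
    (h : IsRadialKHessianSol N k m R b u) :
    StrictMonoOn (fun s => s ^ (N - k) * deriv u s ^ k) (Ioo 0 R) := by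
  have hf := h.flux hk hN
  refine strictMonoOn_of_deriv_pos (convex_Ioo 0 R)
    (fun r hr => (hf r hr).continuousAt.continuousWithinAt) ?_
  rw [interior_Ioo]
  intro r hr
  rw [(hf r hr).deriv]
  exact mul_pos (pow_pos hr.1 _) (Real.rpow_pos_of_pos (h.pos r hr) _)

/-- A negative flux near the origin would make the solution unbounded there. -/
lemma IsRadialKHessianSol.flux_pos (hk : 1 ≤ k) (hN : 2 * (k : ℝ) < N)
    (h : IsRadialKHessianSol N k m R b u) : ∀ r ∈ Ioo 0 R, 0 < r ^ (N - k) * deriv u r ^ k := by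
  have hmono := h.strictMonoOn_flux hk hN
  intro r₁ hr₁
  by_contra hcon
  set r₂ := min (r₁ / 2) 1 with hr₂
  have h20 : 0 < r₂ := lt_min (half_pos hr₁.1) one_pos
  have h21 : r₂ < r₁ := (min_le_left _ _).trans_lt (half_lt_self hr₁.1)
  have h2R : r₂ ∈ Ioo 0 R := ⟨h20, h21.trans hr₁.2⟩
  have hκ := (hmono h2R hr₁ h21).trans_le (not_lt.1 hcon)
  simp only at hκ
  set κ := -(r₂ ^ (N - k) * deriv u r₂ ^ k) with hκdef
  have hκ0 : 0 < κ := by linarith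
  have key : ∀ r ∈ Ioo 0 r₂, deriv u r ≤ -(κ ^ (k : ℝ)⁻¹ / r) := by
    intro r hr
    have hrR : r ∈ Ioo 0 R := ⟨hr.1, hr.2.trans h2R.2⟩
    have h1 := hmono hrR h2R hr.2
    simp only at h1
    have hneg : deriv u r < 0 := by
      by_contra h'
      have := mul_nonneg (pow_nonneg hr.1.le (N - k)) (pow_nonneg (not_lt.1 h') k)
      linarith
    have h2 := div_le_abs_of_le_abs_flux (y := deriv u r) hk hN hκ0.le hr.1
      (hr.2.le.trans (min_le_right _ _)) (by rw [abs_of_neg (by linarith)]; linarith)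
    rw [abs_of_neg hneg] at h2
    linarith
  exact not_tendsto_atTop_of_tendsto_nhds (h.tendsto_nhds (hr₁.1.trans hr₁.2))
    (tendsto_atTop_of_deriv_le_neg_div h20 (Real.rpow_pos_of_pos hκ0 _)
      (fun r hr => h.hasDerivAt r ⟨hr.1, hr.2.trans h2R.2⟩) key)

lemma IsRadialKHessianSol.deriv_sign (hk : 1 ≤ k) (hN : 2 * (k : ℝ) < N)
    (h : IsRadialKHessianSol N k m R b u) :
    (∀ r ∈ Ioo 0 R, 0 < deriv u r) ∨ (∀ r ∈ Ioo 0 R, deriv u r < 0) := by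
  have hne : ∀ r ∈ Ioo 0 R, deriv u r ≠ 0 := by
    intro r hr h0
    have := h.flux_pos hk hN r hr
    rw [h0, zero_pow (by omega), mul_zero] at this
    exact lt_irrefl _ this
  by_contra! hcon
  obtain ⟨⟨x, hx, hx'⟩, y, hy, hy'⟩ := hcon
  obtain ⟨z, hz, hz'⟩ := isPreconnected_Ioo.intermediate_value hx hy
    h.contDiffOn_deriv.continuousOn ⟨hx', hy'⟩
  exact hne z hz hz'

lemma IsRadialKHessianSol.flux_tendsto_zero (hk : 1 ≤ k) (hN : 2 * (k : ℝ) < N) (hR : 0 < R)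
    (h : IsRadialKHessianSol N k m R b u) :
    Tendsto (fun s => s ^ (N - k) * deriv u s ^ k) (𝓝[>] 0) (𝓝 0) := by
  have hmono := h.strictMonoOn_flux hk hN
  have hpos := h.flux_pos hk hN
  rw [tendsto_order]
  constructor
  · intro a ha
    filter_upwards [Ioo_mem_nhdsGT hR] with r hr
    exact ha.trans (hpos r hr)
  · intro ε hε
    by_contra hcon
    have hge : ∀ r ∈ Ioo 0 R, ε ≤ r ^ (N - k) * deriv u r ^ k := by
      intro r hr
      obtain ⟨s, hs, hs'⟩ := ((not_eventually.1 hcon).and_eventually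
        (Ioo_mem_nhdsGT hr.1)).exists
      exact (not_lt.1 hs).trans (hmono.monotoneOn ⟨hs'.1, hs'.2.trans hr.2⟩ hr hs'.2.le)
    set δ := min R 1
    have hδ : 0 < δ := lt_min hR one_pos
    have hc := Real.rpow_pos_of_pos hε (k : ℝ)⁻¹
    have hsub : ∀ r ∈ Ioo 0 δ, r ∈ Ioo 0 R := fun r hr => ⟨hr.1, hr.2.trans_le (min_le_left _ _)⟩
    have habs : ∀ r ∈ Ioo 0 δ, ε ^ (k : ℝ)⁻¹ / r ≤ |deriv u r| := fun r hr =>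
      div_le_abs_of_le_abs_flux hk hN hε.le hr.1 (hr.2.le.trans (min_le_right _ _))
        ((hge r (hsub r hr)).trans (le_abs_self _))
    rcases h.deriv_sign hk hN with hs | hs
    · refine not_tendsto_atTop_of_tendsto_nhds (h.tendsto_nhds hR).neg
        (tendsto_atTop_of_deriv_le_neg_div hδ hc
          (fun r hr => (h.hasDerivAt r (hsub r hr)).neg) fun r hr => ?_)
      have := habs r hr
      rw [abs_of_pos (hs r (hsub r hr))] at this
      linarith
    · refine not_tendsto_atTop_of_tendsto_nhds (h.tendsto_nhds hR)
        (tendsto_atTop_of_deriv_le_neg_div hδ hc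
          (fun r hr => h.hasDerivAt r (hsub r hr)) fun r hr => ?_)
      have := habs r hr
      rw [abs_of_neg (hs r (hsub r hr))] at this
      linarith

/-- Comparison of functions with limits at the origin through their derivatives. -/
lemma nonneg_of_deriv_nonneg_of_tendsto {f f' : ℝ → ℝ} {l : ℝ} (hl : 0 ≤ l)
    (hf : ∀ r ∈ Ioo 0 R, HasDerivAt f (f' r) r) (hf' : ∀ r ∈ Ioo 0 R, 0 ≤ f' r)
    (h0 : Tendsto f (𝓝[>] 0) (𝓝 l)) : ∀ r ∈ Ioo 0 R, 0 ≤ f r := by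
  have hmono : MonotoneOn f (Ioo 0 R) := by
    refine monotoneOn_of_deriv_nonneg (convex_Ioo 0 R)
      (fun r hr => (hf r hr).continuousAt.continuousWithinAt) ?_ ?_
    · rw [interior_Ioo]
      exact fun r hr => (hf r hr).differentiableAt.differentiableWithinAt
    · rw [interior_Ioo]
      intro r hr
      rw [(hf r hr).deriv]
      exact hf' r hr
  intro r hr
  refine hl.trans (le_of_tendsto h0 ?_)
  filter_upwards [Ioo_mem_nhdsGT hr.1] with s hs
  exact hmono ⟨hs.1, hs.2.trans hr.2⟩ hr hs.2.le

/-- On a large ball a decreasing solution with central value below `1` would become negative, so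
every solution is increasing. -/
lemma IsRadialKHessianSol.radialFlow (hk : 1 ≤ k) (hm : (k : ℝ) < m) (hN : 2 * (k : ℝ) < N)
    (hb : b < 1) (h : IsRadialKHessianSol N k m (2 * N) b u) :
    RadialFlow N k m (2 * N) u (deriv u) := by
  have hN' : 2 * k < N := by exact_mod_cast hN
  have hN3 : (3 : ℝ) ≤ N := by exact_mod_cast (by omega : 3 ≤ N)
  have hR : (0 : ℝ) < 2 * N := by linarith
  have h0 := h.flux_tendsto_zero hk hN hR
  refine ⟨h.pos, ?_, h.hasDerivAt, h.flux hk hN, h0⟩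
  rcases h.deriv_sign hk hN with hs | hs
  · exact hs
  exfalso
  -- `u` stays below `1`, so the right-hand side of the equation is at least `1`.
  have hub : ∀ r ∈ Ioo 0 (2 * (N : ℝ)), u r < 1 := by
    intro r hr
    have := nonneg_of_deriv_nonneg_of_tendsto (f := fun s => b - u s) le_rfl
      (fun s hs' => (h.hasDerivAt s hs').const_sub b) (fun s hs' => by linarith [hs s hs'])
      (by simpa using (h.tendsto_nhds hR).const_sub b) r hr
    linarith
  have hw : ∀ r ∈ Ioo 0 (2 * (N : ℝ)), r ^ N / N ≤ r ^ (N - k) * deriv u r ^ k := by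
    intro r hr
    have h1 : ∀ s ∈ Ioo 0 (2 * (N : ℝ)), HasDerivAt
        (fun s => s ^ (N - k) * deriv u s ^ k - s ^ N / N)
        (s ^ (N - 1) * u s ^ (-m) - N * s ^ (N - 1) / N) s := fun s hs' =>
      (h.flux hk hN s hs').sub ((hasDerivAt_pow N s).div_const _)
    have h2 := nonneg_of_deriv_nonneg_of_tendsto le_rfl h1 ?_ ?_ r hr
    · linarith
    · intro s hs'
      rw [mul_div_cancel_left₀ _ (by linarith : (N : ℝ) ≠ 0)]
      have h3 : 1 ≤ u s ^ (-m) := by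
        have : (0 : ℝ) < k := by exact_mod_cast hk
        exact Real.one_le_rpow_of_pos_of_le_one_of_nonpos (h.pos s hs') (hub s hs').le
          (by linarith)
      nlinarith [pow_pos hs'.1 (N - 1)]
    · have h3 : Tendsto (fun s : ℝ => s ^ N / N) (𝓝[>] 0) (𝓝 (0 ^ N / N)) :=
        ((continuous_pow N).div_const _).continuousAt.tendsto.mono_left nhdsWithin_le_nhds
      simpa [zero_pow (by omega : N ≠ 0)] using h0.sub h3
  have hd : ∀ r ∈ Ioo 0 (2 * (N : ℝ)), deriv u r ≤ -(r / N) := by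
    intro r hr
    have h1 : r / N ≤ |deriv u r| := by
      refine le_of_pow_le_pow_left₀ (by omega : k ≠ 0) (abs_nonneg _) ?_
      have h2 := hw r hr
      have h3 : r ^ N = r ^ (N - k) * r ^ k := by rw [← pow_add]; congr 1; omega
      rw [h3, mul_div_assoc] at h2
      have h4 := le_of_mul_le_mul_left h2 (pow_pos hr.1 _)
      rw [← abs_pow]
      refine le_trans ?_ (h4.trans (le_abs_self _))
      rw [div_pow]
      exact div_le_div_of_nonneg_left (pow_pos hr.1 _).le (by linarith)
        (le_self_pow₀ (by linarith) (by omega))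
    rw [abs_of_neg (hs r hr)] at h1
    linarith
  have hfin := nonneg_of_deriv_nonneg_of_tendsto (R := 2 * N)
    (f := fun s => 1 - u s - s ^ 2 / (2 * N)) (f' := fun s => -deriv u s - 2 * s / (2 * N))
    (l := 1 - b - 0 ^ 2 / (2 * N)) (by simp; exact hb.le)
    (fun s hs' => (((h.hasDerivAt s hs').const_sub 1).sub
      ((hasDerivAt_pow 2 s).div_const (2 * (N : ℝ)))).congr_deriv (by simp))
    (fun s hs' => by
      have := hd s hs'
      rw [mul_div_mul_left _ _ two_ne_zero]
      linarith)
    (((h.tendsto_nhds hR).const_sub 1).sub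
      ((by fun_prop : Continuous fun s : ℝ => s ^ 2 / (2 * N)).continuousAt.tendsto.mono_left
        nhdsWithin_le_nhds)) N ⟨by linarith, by linarith⟩
  have hu := h.pos N ⟨by linarith, by linarith⟩
  have h5 : (N : ℝ) ^ 2 / (2 * N) = N / 2 := by field_simp
  simp only [h5] at hfin
  linarith

end Conversion

/-! ### The phase plane and its Lyapunov function -/

/-- The solution divided by the rupture solution. -/
noncomputable def solRatio (N k : ℕ) (m : ℝ) (u : ℝ → ℝ) (r : ℝ) : ℝ :=
  u r / (ruptureCoeff N k m * r ^ ruptureExp k m)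

/-- The flux `r^{N-k} (u')^k` of the solution divided by the flux of the rupture solution. -/
noncomputable def fluxRatio (N k : ℕ) (m : ℝ) (u' : ℝ → ℝ) (r : ℝ) : ℝ :=
  r ^ (N - k) * u' r ^ k /
    ((ruptureCoeff N k m * ruptureExp k m) ^ k * r ^ fluxExp N k m)

/-- The Lyapunov function of the autonomous system for `(X, P)` (the ratios of the solutions and
of the fluxes) in the variable `log r`. -/
noncomputable def phaseEnergy (N k : ℕ) (m X P : ℝ) : ℝ :=
  ruptureExp k m * powPrimitive (k : ℝ)⁻¹ P + fluxExp N k m * -powPrimitive (-m) X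

section PhasePlane

variable {N k : ℕ} {m R : ℝ} {u u' : ℝ → ℝ}

lemma solRatio_pos (hk : 1 ≤ k) (hm : (k : ℝ) < m) (hN : 2 * (k : ℝ) < N) {r : ℝ} (hr : 0 < r)
    (hu : 0 < u r) : 0 < solRatio N k m u r :=
  div_pos hu (mul_pos (ruptureCoeff_pos hk hm hN) (Real.rpow_pos_of_pos hr _))

lemma fluxRatio_pos (hk : 1 ≤ k) (hm : (k : ℝ) < m) (hN : 2 * (k : ℝ) < N) {r : ℝ} (hr : 0 < r)
    (hu : 0 < u' r) : 0 < fluxRatio N k m u' r := by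
  have := ruptureCoeff_pos hk hm hN
  have := ruptureExp_pos hk hm
  unfold fluxRatio
  positivity

lemma fluxRatio_rpow (hk : 1 ≤ k) (hm : (k : ℝ) < m) (hN : 2 * (k : ℝ) < N) {r : ℝ} (hr : 0 < r)
    (hu : 0 ≤ u' r) :
    fluxRatio N k m u' r ^ (k : ℝ)⁻¹ =
      u' r / (ruptureCoeff N k m * ruptureExp k m * r ^ (ruptureExp k m - 1)) := by
  have hC := ruptureCoeff_pos hk hm hN
  have hθ := ruptureExp_pos hk hm
  have hN' : 2 * k < N := by exact_mod_cast hN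
  have h1 : r ^ fluxExp N k m = r ^ (N - k) * (r ^ (ruptureExp k m - 1)) ^ k := by
    rw [← Real.rpow_natCast, ← Real.rpow_natCast, ← Real.rpow_mul hr.le, ← Real.rpow_add hr,
      Nat.cast_sub (by omega), fluxExp_eq hk hm]
    congr 1
    ring
  have h2 : fluxRatio N k m u' r =
      (u' r / (ruptureCoeff N k m * ruptureExp k m * r ^ (ruptureExp k m - 1))) ^ k := by
    unfold fluxRatio
    have := (Real.rpow_pos_of_pos hr (ruptureExp k m - 1)).ne'
    rw [h1, div_pow, mul_pow _ (r ^ (ruptureExp k m - 1))]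
    field_simp
  rw [h2, Real.pow_rpow_inv_natCast (by positivity) (by omega)]

lemma RadialFlow.hasDerivAt_solRatio (hk : 1 ≤ k) (hm : (k : ℝ) < m) (hN : 2 * (k : ℝ) < N)
    (h : RadialFlow N k m R u u') {r : ℝ} (hr : r ∈ Ioo 0 R) :
    HasDerivAt (solRatio N k m u) (ruptureExp k m *
      (fluxRatio N k m u' r ^ (k : ℝ)⁻¹ - solRatio N k m u r) / r) r := by
  have hC := ruptureCoeff_pos hk hm hN
  have hθ := ruptureExp_pos hk hm
  have hr0 := hr.1
  have hrθ := Real.rpow_pos_of_pos hr0 (ruptureExp k m)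
  have h1 := (h.hasDerivAt r hr).div
    ((Real.hasDerivAt_rpow_const (p := ruptureExp k m) (Or.inl hr.1.ne')).const_mul
      (ruptureCoeff N k m)) (mul_pos hC hrθ).ne'
  refine h1.congr_deriv ?_
  rw [fluxRatio_rpow hk hm hN hr.1 (h.deriv_pos r hr).le, Real.rpow_sub_one hr.1.ne']
  unfold solRatio
  field_simp

lemma RadialFlow.hasDerivAt_fluxRatio (hk : 1 ≤ k) (hm : (k : ℝ) < m) (hN : 2 * (k : ℝ) < N)
    (h : RadialFlow N k m R u u') {r : ℝ} (hr : r ∈ Ioo 0 R) :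
    HasDerivAt (fluxRatio N k m u') (fluxExp N k m *
      (solRatio N k m u r ^ (-m) - fluxRatio N k m u' r) / r) r := by
  have hC := ruptureCoeff_pos hk hm hN
  have hθ := ruptureExp_pos hk hm
  have hA := fluxExp_pos hk hm hN
  have hr0 := hr.1
  have hN' : 2 * k < N := by exact_mod_cast hN
  have hrA := Real.rpow_pos_of_pos hr0 (fluxExp N k m)
  have h1 := (h.flux r hr).div
    ((Real.hasDerivAt_rpow_const (p := fluxExp N k m) (Or.inl hr.1.ne')).const_mul
      ((ruptureCoeff N k m * ruptureExp k m) ^ k)) (by positivity)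
  refine h1.congr_deriv ?_
  have h2 : r ^ (N - 1) = r ^ fluxExp N k m / r * (r ^ ruptureExp k m) ^ m := by
    rw [← Real.rpow_sub_one hr.1.ne', ← Real.rpow_mul hr0.le, ← Real.rpow_add hr0,
      ← Real.rpow_natCast, Nat.cast_sub (by omega)]
    congr 1
    unfold fluxExp
    push_cast
    ring
  have h3 : solRatio N k m u r ^ (-m) = u r ^ (-m) * (r ^ ruptureExp k m) ^ m /
      (fluxExp N k m * (ruptureCoeff N k m * ruptureExp k m) ^ k) := by
    unfold solRatio
    have hrθ := Real.rpow_pos_of_pos hr0 (ruptureExp k m)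
    rw [Real.div_rpow (h.pos r hr).le (by positivity), Real.mul_rpow hC.le hrθ.le,
      ruptureCoeff_neg_rpow hk hm hN, Real.rpow_neg hrθ.le]
    field_simp
  rw [h3, h2, Real.rpow_sub_one hr.1.ne']
  unfold fluxRatio
  have := h.deriv_pos r hr
  field_simp

lemma powPrimitive_bounds_of_pos {p : ℝ} (hp : 0 < p) {x : ℝ} (hx : 0 < x) :
    0 ≤ powPrimitive p x ∧ powPrimitive p x ≤ (x ^ p - 1) * (x - 1) ∧
      (x ≠ 1 → 0 < powPrimitive p x) :=
  convexPrimitive_bounds (g := fun x => x ^ p - 1)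
    (fun _ hx => hasDerivAt_powPrimitive (by positivity) hx)
    (strictMonoOn_rpow_sub_one hp) (powPrimitive_one p) (by simp) hx

lemma powPrimitive_bounds_of_lt_neg_one {p : ℝ} (hp : p < -1) {x : ℝ} (hx : 0 < x) :
    0 ≤ -powPrimitive p x ∧ -powPrimitive p x ≤ -(x ^ p - 1) * (x - 1) ∧
      (x ≠ 1 → 0 < -powPrimitive p x) :=
  convexPrimitive_bounds (G := fun x => -powPrimitive p x) (g := fun x => -(x ^ p - 1))
    (fun _ hx => (hasDerivAt_powPrimitive (by linarith) hx).neg)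
    (strictMonoOn_one_sub_rpow (by linarith)) (by simp [powPrimitive_one]) (by simp) hx

lemma one_lt_of_natCast_lt (hk : 1 ≤ k) (hm : (k : ℝ) < m) : 1 < m :=
  lt_of_le_of_lt (by exact_mod_cast hk) hm

lemma phaseEnergy_parts_nonneg (hk : 1 ≤ k) (hm : (k : ℝ) < m) (hN : 2 * (k : ℝ) < N) {X P : ℝ}
    (hX : 0 < X) (hP : 0 < P) :
    0 ≤ ruptureExp k m * powPrimitive (k : ℝ)⁻¹ P ∧
      0 ≤ fluxExp N k m * -powPrimitive (-m) X := by
  have hk0 : (0 : ℝ) < k := by exact_mod_cast hk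
  have hm1 := one_lt_of_natCast_lt hk hm
  exact ⟨mul_nonneg (ruptureExp_pos hk hm).le (powPrimitive_bounds_of_pos (inv_pos.2 hk0) hP).1,
    mul_nonneg (fluxExp_pos hk hm hN).le
      (powPrimitive_bounds_of_lt_neg_one (by linarith) hX).1⟩

/-- The rate of decay of the energy in the variable `log r`. -/
noncomputable def energyRate (N k : ℕ) (m : ℝ) : ℝ := min (fluxExp N k m) (ruptureExp k m)

lemma energyRate_pos (hk : 1 ≤ k) (hm : (k : ℝ) < m) (hN : 2 * (k : ℝ) < N) :
    0 < energyRate N k m :=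
  lt_min (fluxExp_pos hk hm hN) (ruptureExp_pos hk hm)

/-- The dissipation `θA((P^{1/k} - 1)(P - 1) + (1 - X^{-m})(X - 1))` of the energy controls the
energy itself, by the tangent-line inequality for its two convex parts. -/
lemma energyRate_mul_phaseEnergy_le (hk : 1 ≤ k) (hm : (k : ℝ) < m) (hN : 2 * (k : ℝ) < N)
    {X P : ℝ} (hX : 0 < X) (hP : 0 < P) :
    energyRate N k m * phaseEnergy N k m X P ≤ ruptureExp k m * fluxExp N k m *
      ((P ^ (k : ℝ)⁻¹ - 1) * (P - 1) + -(X ^ (-m) - 1) * (X - 1)) := by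
  have hk0 : (0 : ℝ) < k := by exact_mod_cast hk
  have hm1 := one_lt_of_natCast_lt hk hm
  obtain ⟨h1, h2, -⟩ := powPrimitive_bounds_of_pos (inv_pos.2 hk0) hP
  obtain ⟨h3, h4, -⟩ := powPrimitive_bounds_of_lt_neg_one (p := -m) (by linarith) hX
  have hA := fluxExp_pos hk hm hN
  have hθ := ruptureExp_pos hk hm
  have hc1 : energyRate N k m ≤ fluxExp N k m := min_le_left _ _
  have hc2 : energyRate N k m ≤ ruptureExp k m := min_le_right _ _
  unfold phaseEnergy
  have e1 : energyRate N k m * (ruptureExp k m * powPrimitive (k : ℝ)⁻¹ P) ≤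
      fluxExp N k m * (ruptureExp k m * ((P ^ (k : ℝ)⁻¹ - 1) * (P - 1))) :=
    mul_le_mul hc1 (mul_le_mul_of_nonneg_left h2 hθ.le) (mul_nonneg hθ.le h1) hA.le
  have e2 : energyRate N k m * (fluxExp N k m * -powPrimitive (-m) X) ≤
      ruptureExp k m * (fluxExp N k m * (-(X ^ (-m) - 1) * (X - 1))) :=
    mul_le_mul hc2 (mul_le_mul_of_nonneg_left h4 hA.le) (mul_nonneg hA.le h3) hθ.le
  linarith

/-- The energy along a solution decays at least like `r^{-c}`, where `c` is `energyRate`. -/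
lemma RadialFlow.antitoneOn_energy (hk : 1 ≤ k) (hm : (k : ℝ) < m) (hN : 2 * (k : ℝ) < N)
    (h : RadialFlow N k m R u u') :
    AntitoneOn (fun r => r ^ energyRate N k m *
      phaseEnergy N k m (solRatio N k m u r) (fluxRatio N k m u' r)) (Ioo 0 R) := by
  have hk0 : (0 : ℝ) < k := by exact_mod_cast hk
  have hm1 := one_lt_of_natCast_lt hk hm
  set c := energyRate N k m with hc
  set θ := ruptureExp k m with hθdef
  set A := fluxExp N k m with hAdef
  have key : ∀ r ∈ Ioo 0 R, HasDerivAt (fun r => r ^ c *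
      phaseEnergy N k m (solRatio N k m u r) (fluxRatio N k m u' r))
      (r ^ c / r * (c * phaseEnergy N k m (solRatio N k m u r) (fluxRatio N k m u' r) -
        θ * A * ((fluxRatio N k m u' r ^ (k : ℝ)⁻¹ - 1) * (fluxRatio N k m u' r - 1) +
          -(solRatio N k m u r ^ (-m) - 1) * (solRatio N k m u r - 1)))) r := by
    intro r hr
    have hX := solRatio_pos hk hm hN hr.1 (h.pos r hr)
    have hP := fluxRatio_pos hk hm hN hr.1 (h.deriv_pos r hr)
    have d1 := ((hasDerivAt_powPrimitive (p := (k : ℝ)⁻¹) (by positivity) hP).comp r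
      (h.hasDerivAt_fluxRatio hk hm hN hr)).const_mul θ
    have d2 := ((hasDerivAt_powPrimitive (p := -m) (by linarith) hX).comp r
      (h.hasDerivAt_solRatio hk hm hN hr)).neg.const_mul A
    have d3 := (Real.hasDerivAt_rpow_const (p := c) (Or.inl hr.1.ne')).mul (d1.add d2)
    refine d3.congr_deriv ?_
    rw [Real.rpow_sub_one hr.1.ne']
    have := hr.1.ne'
    simp only [phaseEnergy, Pi.add_apply, Function.comp_apply, Pi.neg_apply,
      ← hθdef, ← hAdef]
    field_simp
    ring
  refine antitoneOn_of_deriv_nonpos (convex_Ioo 0 R)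
    (fun r hr => (key r hr).continuousAt.continuousWithinAt) ?_ ?_
  · rw [interior_Ioo]
    exact fun r hr => (key r hr).differentiableAt.differentiableWithinAt
  · rw [interior_Ioo]
    intro r hr
    rw [(key r hr).deriv]
    have := energyRate_mul_phaseEnergy_le hk hm hN
      (solRatio_pos hk hm hN hr.1 (h.pos r hr)) (fluxRatio_pos hk hm hN hr.1 (h.deriv_pos r hr))
    exact mul_nonpos_of_nonneg_of_nonpos
      (div_nonneg (Real.rpow_nonneg hr.1.le _) hr.1.le) (by linarith)

/-! ### Behaviour of global solutions at infinity -/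

lemma RadialFlow.energy_tendsto_zero (hk : 1 ≤ k) (hm : (k : ℝ) < m) (hN : 2 * (k : ℝ) < N)
    (h : ∀ R, RadialFlow N k m R u u') :
    Tendsto (fun r => phaseEnergy N k m (solRatio N k m u r) (fluxRatio N k m u' r))
      atTop (𝓝 0) := by
  set E := fun r => phaseEnergy N k m (solRatio N k m u r) (fluxRatio N k m u' r)
  have h1 : Tendsto (fun r : ℝ => r ^ (-energyRate N k m) * E 1) atTop (𝓝 (0 * E 1)) :=
    (tendsto_rpow_neg_atTop (energyRate_pos hk hm hN)).mul_const _
  rw [zero_mul] at h1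
  refine tendsto_of_tendsto_of_tendsto_of_le_of_le' tendsto_const_nhds h1 ?_ ?_
  · filter_upwards [eventually_gt_atTop 0] with r hr
    have hr' : r ∈ Ioo 0 (r + 1) := ⟨hr, by linarith⟩
    have := phaseEnergy_parts_nonneg hk hm hN (solRatio_pos hk hm hN hr ((h _).pos r hr'))
      (fluxRatio_pos hk hm hN hr ((h _).deriv_pos r hr'))
    exact add_nonneg this.1 this.2
  · filter_upwards [eventually_ge_atTop 1] with r hr
    have hr0 : 0 < r := by linarith
    have := (h (r + 1)).antitoneOn_energy hk hm hN ⟨one_pos, by linarith⟩ ⟨hr0, by linarith⟩ hr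
    simp only [Real.one_rpow, one_mul] at this
    rw [Real.rpow_neg hr0.le, inv_mul_eq_div, le_div_iff₀ (Real.rpow_pos_of_pos hr0 _), mul_comm]
    exact this

lemma RadialFlow.ratios_tendsto_one (hk : 1 ≤ k) (hm : (k : ℝ) < m) (hN : 2 * (k : ℝ) < N)
    (h : ∀ R, RadialFlow N k m R u u') :
    Tendsto (solRatio N k m u) atTop (𝓝 1) ∧ Tendsto (fluxRatio N k m u') atTop (𝓝 1) := by
  have hk0 : (0 : ℝ) < k := by exact_mod_cast hk
  have hm1 := one_lt_of_natCast_lt hk hm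
  have hA := fluxExp_pos hk hm hN
  have hθ := ruptureExp_pos hk hm
  have hE := RadialFlow.energy_tendsto_zero hk hm hN h
  have hX : ∀ᶠ r in atTop, 0 < solRatio N k m u r := by
    filter_upwards [eventually_gt_atTop 0] with r hr
    exact solRatio_pos hk hm hN hr ((h (r + 1)).pos r ⟨hr, by linarith⟩)
  have hP : ∀ᶠ r in atTop, 0 < fluxRatio N k m u' r := by
    filter_upwards [eventually_gt_atTop 0] with r hr
    exact fluxRatio_pos hk hm hN hr ((h (r + 1)).deriv_pos r ⟨hr, by linarith⟩)
  constructor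
  · refine tendsto_one_of_convexPrimitive (G := fun x => -powPrimitive (-m) x)
      (g := fun x => -(x ^ (-m) - 1))
      (fun _ hx => (hasDerivAt_powPrimitive (by linarith) hx).neg)
      (strictMonoOn_one_sub_rpow (by linarith)) (by simp [powPrimitive_one]) (by simp) hX ?_
    have h0 := hE.div_const (fluxExp N k m)
    rw [zero_div] at h0
    refine tendsto_of_tendsto_of_tendsto_of_le_of_le' tendsto_const_nhds h0 ?_ ?_
    · filter_upwards [hX] with r hr
      exact (powPrimitive_bounds_of_lt_neg_one (by linarith) hr).1
    · filter_upwards [hX, hP] with r hr hr'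
      rw [le_div_iff₀ hA]
      have := (phaseEnergy_parts_nonneg hk hm hN hr hr').1
      unfold phaseEnergy
      linarith
  · refine tendsto_one_of_convexPrimitive (G := powPrimitive (k : ℝ)⁻¹)
      (g := fun x => x ^ (k : ℝ)⁻¹ - 1)
      (fun _ hx => hasDerivAt_powPrimitive (by positivity) hx)
      (strictMonoOn_rpow_sub_one (by positivity)) (powPrimitive_one _) (by simp) hP ?_
    have h0 := hE.div_const (ruptureExp k m)
    rw [zero_div] at h0
    refine tendsto_of_tendsto_of_tendsto_of_le_of_le' tendsto_const_nhds h0 ?_ ?_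
    · filter_upwards [hP] with r hr
      exact (powPrimitive_bounds_of_pos (by positivity) hr).1
    · filter_upwards [hX, hP] with r hr hr'
      rw [le_div_iff₀ hθ]
      have := (phaseEnergy_parts_nonneg hk hm hN hr hr').2
      unfold phaseEnergy
      linarith

end PhasePlane

/-! ### Uniqueness of the rupture solution -/

section Rupture

variable {N k : ℕ} {m R : ℝ} {u u' : ℝ → ℝ}

lemma radialFlow_kHessianRupture (hk : 1 ≤ k) (hm : (k : ℝ) < m) (hN : 2 * (k : ℝ) < N) (R : ℝ) :
    RadialFlow N k m R (kHessianRupture N k m)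
      (fun r => ruptureCoeff N k m * ruptureExp k m * r ^ (ruptureExp k m - 1)) := by
  have hC := ruptureCoeff_pos hk hm hN
  have hθ := ruptureExp_pos hk hm
  have hA := fluxExp_pos hk hm hN
  have hN' : 2 * k < N := by exact_mod_cast hN
  have hflux : ∀ s : ℝ, 0 < s → s ^ (N - k) *
      (ruptureCoeff N k m * ruptureExp k m * s ^ (ruptureExp k m - 1)) ^ k =
      (ruptureCoeff N k m * ruptureExp k m) ^ k * s ^ fluxExp N k m := by
    intro s hs
    have h1 : s ^ fluxExp N k m = s ^ (N - k) * (s ^ (ruptureExp k m - 1)) ^ k := by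
      rw [← Real.rpow_natCast, ← Real.rpow_natCast, ← Real.rpow_mul hs.le, ← Real.rpow_add hs,
        Nat.cast_sub (by omega), fluxExp_eq hk hm]
      congr 1
      ring
    rw [h1, mul_pow _ (s ^ (ruptureExp k m - 1))]
    ring
  refine ⟨fun r hr => mul_pos hC (Real.rpow_pos_of_pos hr.1 _), fun r hr => ?_, fun r hr => ?_,
    fun r hr => ?_, ?_⟩
  · have := Real.rpow_pos_of_pos hr.1 (ruptureExp k m - 1)
    positivity
  · exact ((Real.hasDerivAt_rpow_const (p := ruptureExp k m) (Or.inl hr.1.ne')).const_mul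
      (ruptureCoeff N k m)).congr_deriv (by ring)
  · have h1 := (Real.hasDerivAt_rpow_const (p := fluxExp N k m) (Or.inl hr.1.ne')).const_mul
      ((ruptureCoeff N k m * ruptureExp k m) ^ k)
    refine (h1.congr_of_eventuallyEq ?_).congr_deriv ?_
    · filter_upwards [lt_mem_nhds hr.1] with s hs using hflux s hs
    · have hrθ := Real.rpow_pos_of_pos hr.1 (ruptureExp k m)
      rw [kHessianRupture_eq, Real.mul_rpow hC.le hrθ.le, ruptureCoeff_neg_rpow hk hm hN,
        ← Real.rpow_mul hr.1.le]
      have h2 : r ^ (fluxExp N k m - 1) = r ^ (N - 1) * r ^ (ruptureExp k m * -m) := by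
        rw [← Real.rpow_natCast, ← Real.rpow_add hr.1, Nat.cast_sub (by omega)]
        congr 1
        unfold fluxExp
        push_cast
        ring
      rw [h2]
      ring
  · have h1 : Tendsto (fun s : ℝ => (ruptureCoeff N k m * ruptureExp k m) ^ k *
        s ^ fluxExp N k m) (𝓝[>] 0) (𝓝 ((ruptureCoeff N k m * ruptureExp k m) ^ k *
        0 ^ fluxExp N k m)) :=
      ((Real.continuous_rpow_const hA.le).continuousAt.tendsto.mono_left
        nhdsWithin_le_nhds).const_mul _
    rw [Real.zero_rpow hA.ne', mul_zero] at h1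
    refine h1.congr' ?_
    filter_upwards [self_mem_nhdsWithin] with s hs using (hflux s hs).symm

lemma RadialFlow.strictMonoOn_Ioo (h : RadialFlow N k m R u u') : StrictMonoOn u (Ioo 0 R) := by
  refine strictMonoOn_of_deriv_pos (convex_Ioo 0 R)
    (fun r hr => (h.hasDerivAt r hr).continuousAt.continuousWithinAt) ?_
  rw [interior_Ioo]
  intro r hr
  rw [(h.hasDerivAt r hr).deriv]
  exact h.deriv_pos r hr

lemma RadialFlow.le_flux (hk : 1 ≤ k) (hm : (k : ℝ) < m) (hN : 2 * (k : ℝ) < N)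
    (h : RadialFlow N k m R u u') {r : ℝ} (hr : r ∈ Ioo 0 R) :
    r ^ N * u r ^ (-m) / N ≤ r ^ (N - k) * u' r ^ k := by
  have hN' : 2 * k < N := by exact_mod_cast hN
  have hN0 : (N : ℝ) ≠ 0 := by exact_mod_cast (by omega : N ≠ 0)
  have hm0 : 0 < m := one_pos.trans (one_lt_of_natCast_lt hk hm)
  have hd : ∀ s ∈ Ioo 0 R, HasDerivAt
      (fun s => s ^ (N - k) * u' s ^ k - s ^ N * u r ^ (-m) / N)
      (s ^ (N - 1) * u s ^ (-m) - N * s ^ (N - 1) * u r ^ (-m) / N) s := fun s hs =>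
    (h.flux s hs).sub (((hasDerivAt_pow N s).mul_const _).div_const _)
  have h1 : ∀ s ∈ Ioo 0 r, 0 ≤ s ^ (N - k) * u' s ^ k - s ^ N * u r ^ (-m) / N := by
    refine nonneg_of_deriv_nonneg_of_tendsto le_rfl
      (fun s hs => hd s ⟨hs.1, hs.2.trans hr.2⟩) ?_ ?_
    · intro s hs
      have hs' : s ∈ Ioo 0 R := ⟨hs.1, hs.2.trans hr.2⟩
      have h2 : u r ^ (-m) ≤ u s ^ (-m) :=
        Real.rpow_le_rpow_of_nonpos (h.pos s hs') (h.strictMonoOn_Ioo.monotoneOn hs' hr hs.2.le)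
          (by linarith)
      rw [mul_assoc, mul_div_cancel_left₀ _ hN0, ← mul_sub]
      exact mul_nonneg (pow_nonneg hs.1.le _) (by linarith)
    · have h3 : Tendsto (fun s : ℝ => s ^ N * u r ^ (-m) / N) (𝓝[>] 0)
          (𝓝 (0 ^ N * u r ^ (-m) / N)) :=
        (by fun_prop : Continuous fun s : ℝ => s ^ N * u r ^ (-m) / N).continuousAt.tendsto
          |>.mono_left nhdsWithin_le_nhds
      simpa [zero_pow (by omega : N ≠ 0)] using h.flux_zero.sub h3
  have h4 := ge_of_tendsto ((hd r hr).continuousAt.tendsto.mono_left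
    (nhdsWithin_le_nhds (s := Iio r))) (by
      filter_upwards [Ioo_mem_nhdsLT hr.1] with s hs using h1 s hs)
  linarith

/-- Integrating `u^{m/k} u' ≥ N^{-1/k} r`, a consequence of the lower bound for the flux. -/
lemma RadialFlow.exists_mul_rpow_le (hk : 1 ≤ k) (hm : (k : ℝ) < m) (hN : 2 * (k : ℝ) < N)
    (h : RadialFlow N k m R u u') (h0 : Tendsto u (𝓝[>] 0) (𝓝 0)) :
    ∃ c, 0 < c ∧ ∀ r ∈ Ioo 0 R, c * r ^ ruptureExp k m ≤ u r := by
  have hN' : 2 * k < N := by exact_mod_cast hN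
  have hN0 : (0 : ℝ) < N := by exact_mod_cast (by omega : 0 < N)
  have hk0 : (0 : ℝ) < k := by exact_mod_cast hk
  have hm0 : 0 < m := one_pos.trans (one_lt_of_natCast_lt hk hm)
  set p := m / k with hp
  have hp0 : 0 < p := by positivity
  set ν := (N : ℝ) ^ (-(k : ℝ)⁻¹) with hν
  have hν0 : 0 < ν := Real.rpow_pos_of_pos hN0 _
  set c := (p + 1) * ν / 2 with hc
  have hc0 : 0 < c := by positivity
  have hstep : ∀ r ∈ Ioo 0 R, ν * r ≤ u r ^ p * u' r := by
    intro r hr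
    have hu := h.pos r hr
    have hu' := h.deriv_pos r hr
    have hup := Real.rpow_pos_of_pos hu p
    refine le_of_pow_le_pow_left₀ (by omega : k ≠ 0) (by positivity) ?_
    have h1 := h.le_flux hk hm hN hr
    have h2 : r ^ N = r ^ (N - k) * r ^ k := by rw [← pow_add]; congr 1; omega
    rw [h2, mul_assoc, mul_div_assoc] at h1
    have h3 := le_of_mul_le_mul_left h1 (pow_pos hr.1 _)
    have h4 : (u r ^ p) ^ k = u r ^ m := by
      rw [← Real.rpow_natCast, ← Real.rpow_mul hu.le, hp]
      congr 1
      field_simp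
    have h5 : ν ^ k = (N : ℝ)⁻¹ := by
      rw [hν, Real.rpow_neg hN0.le, inv_pow, Real.rpow_inv_natCast_pow hN0.le (by omega)]
    rw [mul_pow, mul_pow, h4, h5]
    have h6 := Real.rpow_pos_of_pos hu m
    rw [Real.rpow_neg hu.le] at h3
    calc (N : ℝ)⁻¹ * r ^ k = u r ^ m * (r ^ k * (u r ^ m)⁻¹ / N) := by field_simp
      _ ≤ u r ^ m * u' r ^ k := mul_le_mul_of_nonneg_left h3 h6.le
  have hmain := nonneg_of_deriv_nonneg_of_tendsto (R := R)
    (f := fun s => u s ^ (p + 1) - c * s ^ 2)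
    (f' := fun s => u' s * (p + 1) * u s ^ (p + 1 - 1) - c * (((2 : ℕ) : ℝ) * s ^ (2 - 1)))
    (l := 0 ^ (p + 1) - c * 0 ^ 2)
    (by rw [Real.zero_rpow (by positivity)]; simp)
    (fun s hs => ((h.hasDerivAt s hs).rpow_const (Or.inl (h.pos s hs).ne')).sub
      ((hasDerivAt_pow 2 s).const_mul c)) ?_ ?_
  · refine ⟨c ^ (ruptureExp k m / 2), Real.rpow_pos_of_pos hc0 _, fun r hr => ?_⟩
    have h1 : c * r ^ 2 ≤ u r ^ (p + 1) := by
      have := hmain r hr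
      linarith
    have hθ := ruptureExp_pos hk hm
    have h2 := Real.rpow_le_rpow (by positivity) h1 (by positivity : 0 ≤ ruptureExp k m / 2)
    have h3 : (p + 1) * (ruptureExp k m / 2) = 1 := by
      have := ruptureExp_mul hk hm
      rw [hp]
      field_simp
      linarith
    rw [← Real.rpow_mul (h.pos r hr).le, h3, Real.rpow_one,
      Real.mul_rpow hc0.le (by positivity), ← Real.rpow_natCast r 2, ← Real.rpow_mul hr.1.le] at h2
    convert h2 using 3
    push_cast
    ring
  · intro s hs
    have := hstep s hs
    simp only [add_sub_cancel_right, Nat.cast_ofNat, Nat.add_one_sub_one, pow_one]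
    rw [hc]
    nlinarith
  · exact (h0.rpow_const (Or.inr (by positivity))).sub
      ((by fun_prop : Continuous fun s : ℝ => c * s ^ 2).continuousAt.tendsto.mono_left
        nhdsWithin_le_nhds)

lemma RadialFlow.exists_fluxRatio_le (hk : 1 ≤ k) (hm : (k : ℝ) < m) (hN : 2 * (k : ℝ) < N)
    (h : RadialFlow N k m R u u') (h0 : Tendsto u (𝓝[>] 0) (𝓝 0)) :
    ∃ c, 0 < c ∧ ∀ r ∈ Ioo 0 R, fluxRatio N k m u' r ≤ c := by
  obtain ⟨b, hb, hbu⟩ := h.exists_mul_rpow_le hk hm hN h0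
  have hN' : 2 * k < N := by exact_mod_cast hN
  have hm0 : 0 < m := one_pos.trans (one_lt_of_natCast_lt hk hm)
  have hA := fluxExp_pos hk hm hN
  have hC := ruptureCoeff_pos hk hm hN
  have hθ := ruptureExp_pos hk hm
  set A := fluxExp N k m with hAdef
  have hb' := Real.rpow_pos_of_pos hb (-m)
  have hmain := nonneg_of_deriv_nonneg_of_tendsto (R := R)
    (f := fun s => b ^ (-m) / A * s ^ A - s ^ (N - k) * u' s ^ k)
    (f' := fun s => b ^ (-m) / A * (A * s ^ (A - 1)) - s ^ (N - 1) * u s ^ (-m))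
    (l := b ^ (-m) / A * 0 ^ A - 0) (by rw [Real.zero_rpow hA.ne']; simp)
    (fun s hs => ((Real.hasDerivAt_rpow_const (Or.inl hs.1.ne')).const_mul _).sub
      (h.flux s hs)) ?_ ?_
  · refine ⟨b ^ (-m) / A / (ruptureCoeff N k m * ruptureExp k m) ^ k, by positivity,
      fun r hr => ?_⟩
    have h1 := hmain r hr
    have h2 := Real.rpow_pos_of_pos hr.1 A
    unfold fluxRatio
    rw [div_le_div_iff₀ (by positivity) (by positivity)]
    nlinarith [pow_pos (mul_pos hC hθ) k]
  · intro s hs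
    have hsθ := Real.rpow_pos_of_pos hs.1 (ruptureExp k m)
    have h1 : u s ^ (-m) ≤ (b * s ^ ruptureExp k m) ^ (-m) :=
      Real.rpow_le_rpow_of_nonpos (by positivity) (hbu s hs) (by linarith)
    rw [Real.mul_rpow hb.le hsθ.le, ← Real.rpow_mul hs.1.le] at h1
    have h2 : s ^ (A - 1) = s ^ (N - 1) * s ^ (ruptureExp k m * -m) := by
      rw [← Real.rpow_natCast, ← Real.rpow_add hs.1, Nat.cast_sub (by omega)]
      congr 1
      rw [hAdef]
      unfold fluxExp
      push_cast
      ring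
    have h3 : b ^ (-m) / A * (A * s ^ (A - 1)) =
        s ^ (N - 1) * (b ^ (-m) * s ^ (ruptureExp k m * -m)) := by
      rw [h2]
      field_simp
    rw [h3, ← mul_sub]
    exact mul_nonneg (pow_nonneg hs.1.le _) (by linarith)
  · exact (((Real.continuous_rpow_const hA.le).continuousAt.tendsto.mono_left
      nhdsWithin_le_nhds).const_mul _).sub h.flux_zero

lemma RadialFlow.exists_solRatio_le (hk : 1 ≤ k) (hm : (k : ℝ) < m) (hN : 2 * (k : ℝ) < N)
    (h : RadialFlow N k m R u u') (h0 : Tendsto u (𝓝[>] 0) (𝓝 0)) :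
    ∃ c, 0 < c ∧ ∀ r ∈ Ioo 0 R, solRatio N k m u r ≤ c := by
  obtain ⟨b, hb, hbu⟩ := h.exists_fluxRatio_le hk hm hN h0
  have hC := ruptureCoeff_pos hk hm hN
  have hθ := ruptureExp_pos hk hm
  have hk0 : (0 : ℝ) < k := by exact_mod_cast hk
  set c := b ^ (k : ℝ)⁻¹ with hc
  have hc0 : 0 < c := Real.rpow_pos_of_pos hb _
  have hmain := nonneg_of_deriv_nonneg_of_tendsto (R := R)
    (f := fun s => c * ruptureCoeff N k m * s ^ ruptureExp k m - u s)
    (f' := fun s => c * ruptureCoeff N k m * (ruptureExp k m * s ^ (ruptureExp k m - 1)) - u' s)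
    (l := c * ruptureCoeff N k m * 0 ^ ruptureExp k m - 0)
    (by rw [Real.zero_rpow hθ.ne']; simp)
    (fun s hs => ((Real.hasDerivAt_rpow_const (Or.inl hs.1.ne')).const_mul _).sub
      (h.hasDerivAt s hs)) ?_ ?_
  · refine ⟨c, hc0, fun r hr => ?_⟩
    have h1 := hmain r hr
    have h2 := Real.rpow_pos_of_pos hr.1 (ruptureExp k m)
    unfold solRatio
    rw [div_le_iff₀ (by positivity)]
    linarith
  · intro s hs
    have hP := fluxRatio_pos hk hm hN hs.1 (h.deriv_pos s hs)
    have h1 := Real.rpow_le_rpow hP.le (hbu s hs) (by positivity : 0 ≤ (k : ℝ)⁻¹)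
    have h2 := Real.rpow_pos_of_pos hs.1 (ruptureExp k m - 1)
    rw [fluxRatio_rpow hk hm hN hs.1 (h.deriv_pos s hs).le, div_le_iff₀ (by positivity)] at h1
    rw [← hc] at h1
    linarith
  · exact (((Real.continuous_rpow_const hθ.le).continuousAt.tendsto.mono_left
      nhdsWithin_le_nhds).const_mul _).sub h0

/-- A solution vanishing at the origin has bounded energy there, so the decay estimate for the
energy, read towards the origin, forces the energy to vanish. -/
lemma RadialFlow.eqOn_kHessianRupture (hk : 1 ≤ k) (hm : (k : ℝ) < m) (hN : 2 * (k : ℝ) < N)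
    (h : RadialFlow N k m R u u') (h0 : Tendsto u (𝓝[>] 0) (𝓝 0)) :
    EqOn u (kHessianRupture N k m) (Ioo 0 R) := by
  obtain ⟨b, hb, hbu⟩ := h.exists_mul_rpow_le hk hm hN h0
  obtain ⟨p, hp, hpu⟩ := h.exists_fluxRatio_le hk hm hN h0
  obtain ⟨q, hq, hqu⟩ := h.exists_solRatio_le hk hm hN h0
  have hC := ruptureCoeff_pos hk hm hN
  have hθ := ruptureExp_pos hk hm
  have hA := fluxExp_pos hk hm hN
  have hk0 : (0 : ℝ) < k := by exact_mod_cast hk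
  have hm1 := one_lt_of_natCast_lt hk hm
  set b' := b / ruptureCoeff N k m with hb'
  have hb'0 : 0 < b' := by positivity
  set M := ruptureExp k m * (p ^ (k : ℝ)⁻¹ * p + 1) + fluxExp N k m * (b' ^ (-m) * 1 + q) with hM
  have hE : ∀ r ∈ Ioo 0 R,
      phaseEnergy N k m (solRatio N k m u r) (fluxRatio N k m u' r) ≤ M := by
    intro r hr
    have hX := solRatio_pos hk hm hN hr.1 (h.pos r hr)
    have hP := fluxRatio_pos hk hm hN hr.1 (h.deriv_pos r hr)
    have hrθ := Real.rpow_pos_of_pos hr.1 (ruptureExp k m)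
    have hbX : b' ≤ solRatio N k m u r := by
      unfold solRatio
      rw [hb', div_le_div_iff₀ hC (by positivity)]
      nlinarith [hbu r hr]
    set X := solRatio N k m u r
    set P := fluxRatio N k m u' r
    refine add_le_add (mul_le_mul_of_nonneg_left ?_ hθ.le) (mul_le_mul_of_nonneg_left ?_ hA.le)
    · refine (powPrimitive_bounds_of_pos (inv_pos.2 hk0) hP).2.1.trans ?_
      have h1 := Real.rpow_le_rpow hP.le (hpu r hr) (inv_pos.2 hk0).le
      have h2 := Real.rpow_pos_of_pos hP (k : ℝ)⁻¹
      have h3 := hpu r hr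
      have h4 : P ^ (k : ℝ)⁻¹ * P ≤ p ^ (k : ℝ)⁻¹ * p := mul_le_mul h1 h3 hP.le (h2.le.trans h1)
      nlinarith
    · refine (powPrimitive_bounds_of_lt_neg_one (p := -m) (by linarith) hX).2.1.trans ?_
      have h1 : X ^ (-m) ≤ b' ^ (-m) := Real.rpow_le_rpow_of_nonpos hb'0 hbX (by linarith)
      have h2 := Real.rpow_pos_of_pos hX (-m)
      have h3 := hqu r hr
      nlinarith
  intro r hr
  have hX := solRatio_pos hk hm hN hr.1 (h.pos r hr)
  have hP := fluxRatio_pos hk hm hN hr.1 (h.deriv_pos r hr)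
  have hc := energyRate_pos hk hm hN
  have hle : r ^ energyRate N k m *
      phaseEnergy N k m (solRatio N k m u r) (fluxRatio N k m u' r) ≤ 0 := by
    have hlim : Tendsto (fun s : ℝ => s ^ energyRate N k m * M) (𝓝[>] 0)
        (𝓝 (0 ^ energyRate N k m * M)) :=
      ((Real.continuous_rpow_const hc.le).continuousAt.tendsto.mono_left
        nhdsWithin_le_nhds).mul_const _
    rw [Real.zero_rpow hc.ne', zero_mul] at hlim
    refine ge_of_tendsto hlim ?_
    filter_upwards [Ioo_mem_nhdsGT hr.1] with s hs
    have hs' : s ∈ Ioo 0 R := ⟨hs.1, hs.2.trans hr.2⟩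
    exact (h.antitoneOn_energy hk hm hN hs' hr hs.2.le).trans
      (mul_le_mul_of_nonneg_left (hE s hs') (Real.rpow_nonneg hs.1.le _))
  have hX1 : solRatio N k m u r = 1 := by
    by_contra hne
    have h1 := (powPrimitive_bounds_of_lt_neg_one (p := -m) (by linarith) hX).2.2 hne
    have h2 := (phaseEnergy_parts_nonneg hk hm hN hX hP).1
    have h3 : 0 < phaseEnergy N k m (solRatio N k m u r) (fluxRatio N k m u' r) :=
      add_pos_of_nonneg_of_pos h2 (mul_pos hA h1)
    exact absurd hle (not_le.2 (mul_pos (Real.rpow_pos_of_pos hr.1 _) h3))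
  have hrθ := Real.rpow_pos_of_pos hr.1 (ruptureExp k m)
  exact (div_eq_one_iff_eq (mul_pos hC hrθ).ne').1 hX1

end Rupture

/-! ### The initial value problem at the origin -/

/-- The mean `∫₀¹ t^{N-1} u(rt)^{-m} dt = r^{-N} ∫₀^r s^{N-1} u(s)^{-m} ds` of the right-hand
side. The rescaled form has no singularity at `r = 0`. -/
noncomputable def fluxMean (N : ℕ) (m : ℝ) (u : ℝ → ℝ) (r : ℝ) : ℝ :=
  ∫ t in (0 : ℝ)..1, t ^ (N - 1) * u (r * t) ^ (-m)

/-- The integral operator `u ↦ a + ∫₀^r ρ (fluxMean u ρ)^{1/k} dρ` (after the substitution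
`ρ = rs`), whose fixed points are the solutions with central value `a`. -/
noncomputable def solMap (N k : ℕ) (m a : ℝ) (u : ℝ → ℝ) (r : ℝ) : ℝ :=
  a + r ^ 2 * ∫ s in (0 : ℝ)..1, s * fluxMean N m u (r * s) ^ (k : ℝ)⁻¹

section Picard

variable {N k : ℕ} {m a M R : ℝ} {u v u' v' : ℝ → ℝ}

lemma continuous_rpow_neg_of_le (ha : 0 < a) (hu : Continuous u) (hau : ∀ x, a ≤ u x) :
    Continuous fun x => u x ^ (-m) :=
  hu.rpow_const fun x => Or.inl (ha.trans_le (hau x)).ne'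

lemma continuous_fluxMean (ha : 0 < a) (hu : Continuous u) (hau : ∀ x, a ≤ u x) :
    Continuous (fluxMean N m u) := by
  have h := continuous_rpow_neg_of_le (m := m) ha hu hau
  refine intervalIntegral.continuous_parametric_intervalIntegral_of_continuous'
    (f := fun r t => t ^ (N - 1) * u (r * t) ^ (-m)) ?_ 0 1
  exact (continuous_snd.pow _).mul (h.comp (continuous_fst.mul continuous_snd))

lemma fluxMean_intervalIntegrable (ha : 0 < a) (hu : Continuous u) (hau : ∀ x, a ≤ u x) (r : ℝ) :
    IntervalIntegrable (fun t => t ^ (N - 1) * u (r * t) ^ (-m)) MeasureTheory.volume 0 1 := by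
  have h := continuous_rpow_neg_of_le (m := m) ha hu hau
  exact ((continuous_id.pow _).mul (h.comp (continuous_const.mul continuous_id))).intervalIntegrable
    _ _

lemma fluxMean_le (hm : 0 < m) (ha : 0 < a) (hu : Continuous u) (hau : ∀ x, a ≤ u x) (r : ℝ) :
    fluxMean N m u r ≤ a ^ (-m) := by
  have h : fluxMean N m u r ≤ ∫ _t in (0 : ℝ)..1, a ^ (-m) := by
    refine intervalIntegral.integral_mono_on zero_le_one
      (fluxMean_intervalIntegrable ha hu hau r) intervalIntegrable_const fun t ht => ?_
    have h1 : u (r * t) ^ (-m) ≤ a ^ (-m) :=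
      Real.rpow_le_rpow_of_nonpos ha (hau _) (by linarith)
    have h2 : t ^ (N - 1) ≤ 1 := pow_le_one₀ ht.1 ht.2
    have h3 := Real.rpow_pos_of_pos (ha.trans_le (hau (r * t))) (-m)
    exact (mul_le_of_le_one_left h3.le h2).trans h1
  simpa using h

lemma le_fluxMean (hN : 1 ≤ N) (hm : 0 < m) (ha : 0 < a) (hu : Continuous u)
    (hau : ∀ x, a ≤ u x) {r : ℝ} (hr : 0 ≤ r) (hM : ∀ x ∈ Icc 0 r, u x ≤ M) :
    M ^ (-m) / N ≤ fluxMean N m u r := by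
  have h : ∫ t in (0 : ℝ)..1, t ^ (N - 1) * M ^ (-m) ≤ fluxMean N m u r := by
    refine intervalIntegral.integral_mono_on zero_le_one
      (Continuous.intervalIntegrable (by fun_prop) _ _)
      (fluxMean_intervalIntegrable ha hu hau r) fun t ht => ?_
    refine mul_le_mul_of_nonneg_left ?_ (pow_nonneg ht.1 _)
    exact Real.rpow_le_rpow_of_nonpos (ha.trans_le (hau _))
      (hM _ ⟨mul_nonneg hr ht.1, mul_le_of_le_one_right hr ht.2⟩) (by linarith)
  rw [intervalIntegral.integral_mul_const, integral_pow, Nat.sub_add_cancel hN] at h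
  have h2 : (((N - 1 : ℕ) : ℝ) + 1) = N := by exact_mod_cast Nat.sub_add_cancel hN
  rw [h2, one_pow, zero_pow (by omega), sub_zero, one_div_mul_eq_div] at h
  exact h

lemma fluxMean_pos (hN : 1 ≤ N) (hm : 0 < m) (ha : 0 < a) (hu : Continuous u)
    (hau : ∀ x, a ≤ u x) {r : ℝ} (hr : 0 ≤ r) : 0 < fluxMean N m u r := by
  obtain ⟨M, hM⟩ := (isCompact_Icc (a := 0) (b := r)).bddAbove_image hu.continuousOn
  have hM' : ∀ x ∈ Icc 0 r, u x ≤ M := fun x hx => hM (mem_image_of_mem u hx)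
  have hM0 : 0 < M := (ha.trans_le (hau 0)).trans_le (hM' 0 ⟨le_rfl, hr⟩)
  have hN0 : (0 : ℝ) < N := by exact_mod_cast hN
  exact (div_pos (Real.rpow_pos_of_pos hM0 _) hN0).trans_le (le_fluxMean hN hm ha hu hau hr hM')

lemma fluxMean_nonneg (ha : 0 < a) (hau : ∀ x, a ≤ u x) (r : ℝ) : 0 ≤ fluxMean N m u r :=
  intervalIntegral.integral_nonneg zero_le_one fun _ ht =>
    mul_nonneg (pow_nonneg ht.1 _) (Real.rpow_nonneg (ha.le.trans (hau _)) _)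

lemma continuous_fluxMean_rpow (ha : 0 < a) (hu : Continuous u) (hau : ∀ x, a ≤ u x) :
    Continuous fun r => fluxMean N m u r ^ (k : ℝ)⁻¹ :=
  (continuous_fluxMean ha hu hau).rpow_const fun _ => Or.inr (by positivity)

lemma pow_mul_fluxMean (hN : 1 ≤ N) (r : ℝ) :
    r ^ N * fluxMean N m u r = ∫ s in (0 : ℝ)..r, s ^ (N - 1) * u s ^ (-m) := by
  have h := intervalIntegral.mul_integral_comp_mul_left (a := 0) (b := 1)
    (f := fun s => s ^ (N - 1) * u s ^ (-m)) r
  rw [mul_zero, mul_one] at h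
  rw [← h, fluxMean, ← pow_sub_one_mul (by omega : N ≠ 0) r, mul_comm (r ^ (N - 1)), mul_assoc,
    ← intervalIntegral.integral_const_mul]
  congr 2
  ext t
  ring

lemma solMap_eq_integral (r : ℝ) :
    solMap N k m a u r = a + ∫ s in (0 : ℝ)..r, s * fluxMean N m u s ^ (k : ℝ)⁻¹ := by
  have h := intervalIntegral.mul_integral_comp_mul_left (a := 0) (b := 1)
    (f := fun s => s * fluxMean N m u s ^ (k : ℝ)⁻¹) r
  rw [mul_zero, mul_one] at h
  rw [← h, solMap, sq, mul_assoc, ← intervalIntegral.integral_const_mul]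
  congr 3
  ext t
  ring

lemma hasDerivAt_solMap (ha : 0 < a) (hu : Continuous u) (hau : ∀ x, a ≤ u x) (r : ℝ) :
    HasDerivAt (solMap N k m a u) (r * fluxMean N m u r ^ (k : ℝ)⁻¹) r := by
  have h : solMap N k m a u = fun r =>
      a + ∫ s in (0 : ℝ)..r, s * fluxMean N m u s ^ (k : ℝ)⁻¹ := funext solMap_eq_integral
  rw [h]
  exact ((continuous_id.mul (continuous_fluxMean_rpow ha hu hau)).integral_hasStrictDerivAt
    0 r).hasDerivAt.const_add a

lemma hasDerivAt_pow_mul_fluxMean (hN : 1 ≤ N) (ha : 0 < a) (hu : Continuous u)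
    (hau : ∀ x, a ≤ u x) (r : ℝ) :
    HasDerivAt (fun r => r ^ N * fluxMean N m u r) (r ^ (N - 1) * u r ^ (-m)) r := by
  have h : (fun r => r ^ N * fluxMean N m u r) = fun r =>
      ∫ s in (0 : ℝ)..r, s ^ (N - 1) * u s ^ (-m) := funext (pow_mul_fluxMean hN)
  rw [h]
  exact (((continuous_id.pow (N - 1)).mul
    (continuous_rpow_neg_of_le (m := m) ha hu hau)).integral_hasStrictDerivAt 0 r).hasDerivAt

lemma continuous_solMap (ha : 0 < a) (hu : Continuous u) (hau : ∀ x, a ≤ u x) :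
    Continuous (solMap N k m a u) :=
  continuous_iff_continuousAt.2 fun r => (hasDerivAt_solMap ha hu hau r).continuousAt

lemma le_solMap (ha : 0 < a) (hau : ∀ x, a ≤ u x) (r : ℝ) : a ≤ solMap N k m a u r :=
  le_add_of_nonneg_right (mul_nonneg (sq_nonneg r)
    (intervalIntegral.integral_nonneg zero_le_one fun _ ht =>
      mul_nonneg ht.1 (Real.rpow_nonneg (fluxMean_nonneg ha hau _) _)))

lemma fluxMean_rpow_le (hm : 0 < m) (ha : 0 < a) (hu : Continuous u) (hau : ∀ x, a ≤ u x)
    (r : ℝ) : fluxMean N m u r ^ (k : ℝ)⁻¹ ≤ (a ^ (-m)) ^ (k : ℝ)⁻¹ :=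
  Real.rpow_le_rpow (fluxMean_nonneg ha hau r) (fluxMean_le hm ha hu hau r) (by positivity)

lemma solMap_le (hm : 0 < m) (ha : 0 < a) (hu : Continuous u) (hau : ∀ x, a ≤ u x) (r : ℝ) :
    solMap N k m a u r ≤ a + r ^ 2 * (a ^ (-m)) ^ (k : ℝ)⁻¹ := by
  refine add_le_add le_rfl (mul_le_mul_of_nonneg_left ?_ (sq_nonneg r))
  have hc := continuous_fluxMean_rpow (N := N) (k := k) (m := m) ha hu hau
  have h : ∫ s in (0 : ℝ)..1, s * fluxMean N m u (r * s) ^ (k : ℝ)⁻¹ ≤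
      ∫ _s in (0 : ℝ)..1, (a ^ (-m)) ^ (k : ℝ)⁻¹ := by
    refine intervalIntegral.integral_mono_on zero_le_one
      (Continuous.intervalIntegrable (continuous_id.mul
        (hc.comp (continuous_const.mul continuous_id))) _ _)
      intervalIntegrable_const fun s hs => ?_
    exact (mul_le_of_le_one_left (Real.rpow_nonneg (fluxMean_nonneg ha hau _) _) hs.2).trans
      (fluxMean_rpow_le hm ha hu hau _)
  simpa using h

lemma abs_rpow_sub_rpow_le {p c x y : ℝ} (hp : p ≤ 1) (hc : 0 < c) (hx : c ≤ x) (hy : c ≤ y) :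
    |x ^ p - y ^ p| ≤ |p| * c ^ (p - 1) * |x - y| := by
  refine Convex.norm_image_sub_le_of_norm_hasDerivWithin_le (s := Ici c) (f := fun x => x ^ p)
    (fun z hz => (Real.hasDerivAt_rpow_const (Or.inl (hc.trans_le hz).ne')).hasDerivWithinAt)
    (fun z hz => ?_) (convex_Ici c) hy hx
  have hz0 := hc.trans_le hz
  rw [Real.norm_eq_abs, abs_mul, abs_of_pos (Real.rpow_pos_of_pos hz0 _)]
  exact mul_le_mul_of_nonneg_left (Real.rpow_le_rpow_of_nonpos hc hz (by linarith)) (abs_nonneg p)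

/-- A Lipschitz constant of `u ↦ (fluxMean u)^{1/k}` on functions with values in `[a, M]`. -/
noncomputable def solMapLip (N k : ℕ) (m a M : ℝ) : ℝ :=
  |(k : ℝ)⁻¹| * (M ^ (-m) / N) ^ ((k : ℝ)⁻¹ - 1) * (|-m| * a ^ (-m - 1))

lemma solMapLip_nonneg (ha : 0 < a) (hM : 0 < M) : 0 ≤ solMapLip N k m a M := by
  unfold solMapLip
  have := Real.rpow_pos_of_pos hM (-m)
  positivity

lemma abs_fluxMean_rpow_sub_le (hN : 1 ≤ N) (hk : 1 ≤ k) (hm : 0 < m) (ha : 0 < a)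
    (hu : Continuous u) (hau : ∀ x, a ≤ u x) (hv : Continuous v) (hav : ∀ x, a ≤ v x)
    (huM : ∀ x ∈ Ico 0 R, u x ≤ M) (hvM : ∀ x ∈ Ico 0 R, v x ≤ M) {c : ℝ} (hc : 0 ≤ c) {n : ℕ}
    (huv : ∀ x ∈ Ico 0 R, |u x - v x| ≤ c * x ^ (2 * n)) {r : ℝ} (hr : r ∈ Ico 0 R) :
    |fluxMean N m u r ^ (k : ℝ)⁻¹ - fluxMean N m v r ^ (k : ℝ)⁻¹| ≤
      solMapLip N k m a M * (c * r ^ (2 * n)) := by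
  have hM0 : 0 < M := (ha.trans_le (hau r)).trans_le (huM r hr)
  have hN0 : (0 : ℝ) < N := by exact_mod_cast hN
  have hMm := Real.rpow_pos_of_pos hM0 (-m)
  have hsub : ∀ x ∈ Icc 0 r, x ∈ Ico 0 R := fun x hx => ⟨hx.1, hx.2.trans_lt hr.2⟩
  have hk1 : (1 : ℝ) ≤ k := by exact_mod_cast hk
  have h1 : |fluxMean N m u r - fluxMean N m v r| ≤ |-m| * a ^ (-m - 1) * (c * r ^ (2 * n)) := by
    unfold fluxMean
    rw [← intervalIntegral.integral_sub (fluxMean_intervalIntegrable ha hu hau r)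
      (fluxMean_intervalIntegrable ha hv hav r)]
    have h2 := intervalIntegral.norm_integral_le_of_norm_le_const (a := 0) (b := 1)
      (f := fun t => t ^ (N - 1) * u (r * t) ^ (-m) - t ^ (N - 1) * v (r * t) ^ (-m))
      (C := |-m| * a ^ (-m - 1) * (c * r ^ (2 * n))) (fun t ht => by
        rw [uIoc_of_le zero_le_one] at ht
        have hrt : r * t ∈ Icc 0 r := ⟨mul_nonneg hr.1 ht.1.le, mul_le_of_le_one_right hr.1 ht.2⟩
        rw [← mul_sub, Real.norm_eq_abs, abs_mul, abs_of_pos (pow_pos ht.1 _)]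
        refine (mul_le_of_le_one_left (abs_nonneg _) (pow_le_one₀ ht.1.le ht.2)).trans ?_
        refine (abs_rpow_sub_rpow_le (by linarith) ha (hau _) (hav _)).trans ?_
        refine mul_le_mul_of_nonneg_left ((huv _ (hsub _ hrt)).trans ?_) (by positivity)
        exact mul_le_mul_of_nonneg_left (pow_le_pow_left₀ hrt.1 hrt.2 _) hc)
    simpa using h2
  have h3 := abs_rpow_sub_rpow_le (p := (k : ℝ)⁻¹) (inv_le_one_of_one_le₀ hk1)
    (div_pos hMm hN0)
    (le_fluxMean hN hm ha hu hau hr.1 fun x hx => huM x (hsub x hx))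
    (le_fluxMean hN hm ha hv hav hr.1 fun x hx => hvM x (hsub x hx))
  refine h3.trans ?_
  unfold solMapLip
  rw [mul_assoc (|(k : ℝ)⁻¹| * _)]
  exact mul_le_mul_of_nonneg_left h1 (by positivity)

/-- The integral operator gains a factor `r²/(2n+2)`, as Volterra operators do. -/
lemma abs_solMap_sub_le (hN : 1 ≤ N) (hk : 1 ≤ k) (hm : 0 < m) (ha : 0 < a)
    (hu : Continuous u) (hau : ∀ x, a ≤ u x) (hv : Continuous v) (hav : ∀ x, a ≤ v x)
    (huM : ∀ x ∈ Ico 0 R, u x ≤ M) (hvM : ∀ x ∈ Ico 0 R, v x ≤ M) {c : ℝ} (hc : 0 ≤ c) {n : ℕ}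
    (huv : ∀ x ∈ Ico 0 R, |u x - v x| ≤ c * x ^ (2 * n)) {r : ℝ} (hr : r ∈ Ico 0 R) :
    |solMap N k m a u r - solMap N k m a v r| ≤
      solMapLip N k m a M * c / (2 * (n + 1)) * r ^ (2 * (n + 1)) := by
  have hcu := continuous_fluxMean_rpow (N := N) (k := k) (m := m) ha hu hau
  have hcv := continuous_fluxMean_rpow (N := N) (k := k) (m := m) ha hv hav
  set L := solMapLip N k m a M with hL
  have e : solMap N k m a u r - solMap N k m a v r = r ^ 2 * ∫ s in (0 : ℝ)..1,
      (s * fluxMean N m u (r * s) ^ (k : ℝ)⁻¹ - s * fluxMean N m v (r * s) ^ (k : ℝ)⁻¹) := by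
    rw [intervalIntegral.integral_sub]
    · unfold solMap
      ring
    · exact Continuous.intervalIntegrable (continuous_id.mul
        (hcu.comp (continuous_const.mul continuous_id))) _ _
    · exact Continuous.intervalIntegrable (continuous_id.mul
        (hcv.comp (continuous_const.mul continuous_id))) _ _
  have h1 : |∫ s in (0 : ℝ)..1,
      (s * fluxMean N m u (r * s) ^ (k : ℝ)⁻¹ - s * fluxMean N m v (r * s) ^ (k : ℝ)⁻¹)| ≤
      ∫ s in (0 : ℝ)..1, L * c * r ^ (2 * n) * s ^ (2 * n + 1) := by
    rw [← Real.norm_eq_abs]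
    refine intervalIntegral.norm_integral_le_of_norm_le
      (μ := MeasureTheory.volume) (g := fun s => L * c * r ^ (2 * n) * s ^ (2 * n + 1)) zero_le_one
      (Eventually.of_forall fun s hs => ?_) (Continuous.intervalIntegrable (by fun_prop) _ _)
    have hrs : r * s ∈ Ico 0 R :=
      ⟨mul_nonneg hr.1 hs.1.le, (mul_le_of_le_one_right hr.1 hs.2).trans_lt hr.2⟩
    rw [← mul_sub, Real.norm_eq_abs, abs_mul, abs_of_pos hs.1]
    have h2 := abs_fluxMean_rpow_sub_le hN hk hm ha hu hau hv hav huM hvM hc huv hrs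
    refine (mul_le_mul_of_nonneg_left h2 hs.1.le).trans (le_of_eq ?_)
    rw [hL]
    ring
  rw [intervalIntegral.integral_const_mul, integral_pow] at h1
  rw [e, abs_mul, abs_of_nonneg (sq_nonneg r)]
  refine (mul_le_mul_of_nonneg_left h1 (sq_nonneg r)).trans (le_of_eq ?_)
  push_cast
  rw [one_pow, zero_pow (by omega)]
  field_simp
  ring

/-- The coefficients `K (L/2)^n / n!` obtained by iterating `abs_solMap_sub_le`. -/
lemma volterra_coeff_succ (L K : ℝ) (n : ℕ) :
    L * (K * (L / 2) ^ n / n.factorial) / (2 * (n + 1)) =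
      K * (L / 2) ^ (n + 1) / (n + 1).factorial := by
  rw [Nat.factorial_succ]
  push_cast
  have : (n.factorial : ℝ) ≠ 0 := by positivity
  field_simp
  ring

/-- Fixed points of the integral operator on `[0, R)` coincide. -/
lemma eqOn_of_solMap_eq (hN : 1 ≤ N) (hk : 1 ≤ k) (hm : 0 < m) (ha : 0 < a)
    (hu : Continuous u) (hau : ∀ x, a ≤ u x) (hv : Continuous v) (hav : ∀ x, a ≤ v x)
    (hTu : ∀ x ∈ Ico 0 R, solMap N k m a u x = u x)
    (hTv : ∀ x ∈ Ico 0 R, solMap N k m a v x = v x) : EqOn u v (Ico 0 R) := by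
  set B := (a ^ (-m)) ^ (k : ℝ)⁻¹ with hB
  have hB0 : 0 < B := Real.rpow_pos_of_pos (Real.rpow_pos_of_pos ha _) _
  set M := a + R ^ 2 * B with hM
  have hbound : ∀ w : ℝ → ℝ, Continuous w → (∀ x, a ≤ w x) →
      (∀ x ∈ Ico 0 R, solMap N k m a w x = w x) → ∀ x ∈ Ico 0 R, w x ≤ M := by
    intro w hw haw hTw x hx
    rw [← hTw x hx]
    refine (solMap_le hm ha hw haw x).trans ?_
    have := pow_le_pow_left₀ hx.1 hx.2.le 2
    have := mul_le_mul_of_nonneg_right this hB0.le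
    linarith
  have huM := hbound u hu hau hTu
  have hvM := hbound v hv hav hTv
  have hM0 : 0 < M := by positivity
  have hL0 := solMapLip_nonneg (N := N) (k := k) (m := m) ha hM0
  set L := solMapLip N k m a M
  have key : ∀ n : ℕ, ∀ x ∈ Ico 0 R,
      |u x - v x| ≤ M * (L / 2) ^ n / n.factorial * x ^ (2 * n) := by
    intro n
    induction n with
    | zero =>
      intro x hx
      have h1 := huM x hx
      have h2 := hvM x hx
      have h3 := hau x
      have h4 := hav x
      simp only [pow_zero, Nat.factorial_zero, Nat.cast_one, mul_zero, mul_one, div_one]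
      rw [abs_le]
      constructor <;> linarith
    | succ n ih =>
      intro x hx
      have h1 := abs_solMap_sub_le hN hk hm ha hu hau hv hav huM hvM (by positivity) ih hx
      rw [hTu x hx, hTv x hx, volterra_coeff_succ] at h1
      exact h1
  intro x hx
  have hlim : Tendsto (fun n : ℕ => M * ((L / 2 * x ^ 2) ^ n / n.factorial)) atTop (𝓝 (M * 0)) :=
    (FloorSemiring.tendsto_pow_div_factorial_atTop _).const_mul M
  rw [mul_zero] at hlim
  have h0 : |u x - v x| ≤ 0 := by
    refine ge_of_tendsto' hlim fun n => (key n x hx).trans (le_of_eq ?_)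
    rw [mul_pow, ← pow_mul]
    ring
  exact sub_eq_zero.1 (abs_nonpos_iff.1 h0)

/-- The Picard iterates converge to a fixed point of the integral operator. -/
lemma exists_solMap_eq (hN : 1 ≤ N) (hk : 1 ≤ k) (hm : 0 < m) (ha : 0 < a) :
    ∃ u : ℝ → ℝ, Continuous u ∧ (∀ x, a ≤ u x) ∧ ∀ x, 0 ≤ x → solMap N k m a u x = u x := by
  set B := (a ^ (-m)) ^ (k : ℝ)⁻¹ with hB
  have hB0 : 0 < B := Real.rpow_pos_of_pos (Real.rpow_pos_of_pos ha _) _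
  set T := solMap N k m a with hT
  set w : ℕ → ℝ → ℝ := fun n => T^[n] fun _ => a with hw
  have hws : ∀ n, w (n + 1) = T (w n) := fun n => Function.iterate_succ_apply' _ _ _
  have hwc : ∀ n, Continuous (w n) ∧ ∀ x, a ≤ w n x := by
    intro n
    induction n with
    | zero => exact ⟨continuous_const, fun _ => le_rfl⟩
    | succ n ih =>
      rw [hws]
      exact ⟨continuous_solMap ha ih.1 ih.2, le_solMap ha ih.2⟩
  have hwle : ∀ n x, w n x ≤ a + x ^ 2 * B := by
    intro n x
    cases n with
    | zero => exact le_add_of_nonneg_right (by positivity)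
    | succ n =>
      rw [hws]
      exact solMap_le hm ha (hwc n).1 (hwc n).2 x
  have hcauchy : ∀ x, 0 ≤ x → ∃ l, Tendsto (fun n => w n x) atTop (𝓝 l) := by
    intro x hx
    set R := x + 1 with hR
    set M := a + R ^ 2 * B with hM
    have hM0 : 0 < M := by positivity
    have hwM : ∀ n, ∀ y ∈ Ico 0 R, w n y ≤ M := by
      intro n y hy
      have := mul_le_mul_of_nonneg_right (pow_le_pow_left₀ hy.1 hy.2.le 2) hB0.le
      linarith [hwle n y]
    have hL0 := solMapLip_nonneg (N := N) (k := k) (m := m) ha hM0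
    set L := solMapLip N k m a M
    have key : ∀ n : ℕ, ∀ y ∈ Ico 0 R,
        |w n y - w (n + 1) y| ≤ M * (L / 2) ^ n / n.factorial * y ^ (2 * n) := by
      intro n
      induction n with
      | zero =>
        intro y hy
        have h1 := hwM 0 y hy
        have h2 := hwM 1 y hy
        have h3 := (hwc 0).2 y
        have h4 := (hwc 1).2 y
        simp only [pow_zero, Nat.factorial_zero, Nat.cast_one, mul_zero, mul_one, div_one,
          zero_add]
        rw [abs_le]
        constructor <;> linarith
      | succ n ih =>
        intro y hy
        have h1 := abs_solMap_sub_le hN hk hm ha (hwc n).1 (hwc n).2 (hwc (n + 1)).1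
          (hwc (n + 1)).2 (hwM n) (hwM (n + 1)) (by positivity) ih hy
        rw [volterra_coeff_succ, ← hT, ← hws, ← hws] at h1
        exact h1
    have hsum : Summable fun n : ℕ => M * ((L / 2 * x ^ 2) ^ n / n.factorial) :=
      (Real.summable_pow_div_factorial _).mul_left M
    refine cauchySeq_tendsto_of_complete (cauchySeq_of_dist_le_of_summable _ (fun n => ?_) hsum)
    rw [Real.dist_eq]
    refine (key n x ⟨hx, by linarith⟩).trans (le_of_eq ?_)
    rw [mul_pow, ← pow_mul]
    ring
  choose! g hg using hcauchy
  have hga : ∀ x, 0 ≤ x → a ≤ g x := fun x hx => ge_of_tendsto' (hg x hx) fun n => (hwc n).2 x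
  -- The iterates are uniformly Lipschitz on bounded sets, hence so is the limit.
  have hlip : ∀ R, ∀ x ∈ Icc 0 R, ∀ y ∈ Icc 0 R, |g y - g x| ≤ R * B * |y - x| := by
    intro R x hx y hy
    have hR : 0 ≤ R := hx.1.trans hx.2
    refine le_of_tendsto (((hg y hy.1).sub (hg x hx.1)).abs) ?_
    filter_upwards [eventually_ge_atTop 1] with n hn
    obtain ⟨n, rfl⟩ : ∃ j, n = j + 1 := ⟨n - 1, by omega⟩
    rw [hws]
    refine Convex.norm_image_sub_le_of_norm_hasDerivWithin_le (s := Icc 0 R)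
      (fun z _ => (hasDerivAt_solMap ha (hwc n).1 (hwc n).2 z).hasDerivWithinAt)
      (fun z hz => ?_) (convex_Icc 0 R) hx hy
    have h1 := Real.rpow_nonneg (fluxMean_nonneg (N := N) (m := m) ha (hwc n).2 z) (k : ℝ)⁻¹
    rw [Real.norm_eq_abs, abs_of_nonneg (mul_nonneg hz.1 h1)]
    exact mul_le_mul hz.2 (fluxMean_rpow_le hm ha (hwc n).1 (hwc n).2 z) h1 hR
  have hgc : ContinuousOn g (Ici 0) := by
    intro x hx
    have h1 : ContinuousOn g (Icc 0 (x + 1)) := by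
      have : LipschitzOnWith (Real.toNNReal ((x + 1) * B)) g (Icc 0 (x + 1)) := by
        refine LipschitzOnWith.of_dist_le_mul fun y hy z hz => ?_
        rw [Real.dist_eq, Real.dist_eq, Real.coe_toNNReal _
          (mul_nonneg (by linarith [mem_Ici.1 hx]) hB0.le)]
        exact hlip (x + 1) z hz y hy
      exact this.continuousOn
    refine (h1 x ⟨hx, by linarith⟩).mono_of_mem_nhdsWithin ?_
    have h2 : Iio (x + 1) ∈ 𝓝 x := Iio_mem_nhds (by linarith)
    filter_upwards [self_mem_nhdsWithin, mem_nhdsWithin_of_mem_nhds h2] with y hy hy'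
    exact ⟨hy, (mem_Iio.1 hy').le⟩
  have hgabs : ∀ x, a ≤ g |x| := fun x => hga _ (abs_nonneg x)
  refine ⟨fun x => g |x|, hgc.comp_continuous continuous_abs fun x => abs_nonneg x, hgabs,
    fun r hr => ?_⟩
  have hlimw : ∀ x, 0 ≤ x → Tendsto (fun n => w n x) atTop (𝓝 (g |x|)) := by
    intro x hx
    rw [abs_of_nonneg hx]
    exact hg x hx
  have hΦ : ∀ x, 0 ≤ x →
      Tendsto (fun n => fluxMean N m (w n) x) atTop (𝓝 (fluxMean N m (fun x => g |x|) x)) := by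
    intro x hx
    refine intervalIntegral.tendsto_integral_filter_of_dominated_convergence
      (fun _ => a ^ (-m)) (Eventually.of_forall fun n => ?_)
      (Eventually.of_forall fun n => Eventually.of_forall fun t ht => ?_)
      intervalIntegrable_const (Eventually.of_forall fun t ht => ?_)
    · exact (fluxMean_intervalIntegrable ha (hwc n).1 (hwc n).2 x).def'.aestronglyMeasurable
    · rw [uIoc_of_le zero_le_one] at ht
      have h1 := Real.rpow_pos_of_pos (ha.trans_le ((hwc n).2 (x * t))) (-m)
      rw [Real.norm_eq_abs, abs_of_nonneg (mul_nonneg (pow_nonneg ht.1.le _) h1.le)]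
      exact (mul_le_of_le_one_left h1.le (pow_le_one₀ ht.1.le ht.2)).trans
        (Real.rpow_le_rpow_of_nonpos ha ((hwc n).2 _) (by linarith))
    · rw [uIoc_of_le zero_le_one] at ht
      have h1 := hlimw (x * t) (mul_nonneg hx ht.1.le)
      exact (h1.rpow_const (Or.inl (ha.trans_le (hgabs _)).ne')).const_mul _
  have hTlim : Tendsto (fun n => T (w n) r) atTop (𝓝 (T (fun x => g |x|) r)) := by
    refine Tendsto.const_add _ (Tendsto.const_mul _ ?_)
    refine intervalIntegral.tendsto_integral_filter_of_dominated_convergence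
      (fun _ => B) (Eventually.of_forall fun n => ?_)
      (Eventually.of_forall fun n => Eventually.of_forall fun s hs => ?_)
      intervalIntegrable_const (Eventually.of_forall fun s hs => ?_)
    · exact (Continuous.intervalIntegrable (continuous_id.mul
        ((continuous_fluxMean_rpow ha (hwc n).1 (hwc n).2).comp
          (continuous_const.mul continuous_id))) _ _).def'.aestronglyMeasurable
    · rw [uIoc_of_le zero_le_one] at hs
      have h1 := Real.rpow_nonneg (fluxMean_nonneg (N := N) (m := m) ha (hwc n).2 (r * s)) (k : ℝ)⁻¹
      rw [Real.norm_eq_abs, abs_of_nonneg (mul_nonneg hs.1.le h1)]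
      exact (mul_le_of_le_one_left h1 hs.2).trans (fluxMean_rpow_le hm ha (hwc n).1 (hwc n).2 _)
    · rw [uIoc_of_le zero_le_one] at hs
      exact ((hΦ _ (mul_nonneg hr hs.1.le)).rpow_const (Or.inr (by positivity))).const_mul _
  refine tendsto_nhds_unique hTlim ?_
  have h1 := (hlimw r hr).comp (tendsto_add_atTop_nat 1)
  refine h1.congr fun n => ?_
  simp only [Function.comp_apply, hws]

/-- A global increasing solution with prescribed central value. -/
lemma exists_radialFlow (hk : 1 ≤ k) (hm : (k : ℝ) < m) (hN : 2 * (k : ℝ) < N) (ha : 0 < a) :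
    ∃ u u' : ℝ → ℝ, Continuous u ∧ u 0 = a ∧ ∀ R, RadialFlow N k m R u u' := by
  have hN' : 2 * k < N := by exact_mod_cast hN
  have hN1 : 1 ≤ N := by omega
  have hm0 : 0 < m := one_pos.trans (one_lt_of_natCast_lt hk hm)
  obtain ⟨u, hu, hau, hTu⟩ := exists_solMap_eq (k := k) hN1 hk hm0 ha
  refine ⟨u, fun r => r * fluxMean N m u r ^ (k : ℝ)⁻¹, hu, ?_, fun R => ?_⟩
  · rw [← hTu 0 le_rfl]
    simp [solMap]
  have hw : ∀ s : ℝ, 0 < s → s ^ (N - k) * (s * fluxMean N m u s ^ (k : ℝ)⁻¹) ^ k =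
      s ^ N * fluxMean N m u s := by
    intro s hs
    rw [mul_pow, Real.rpow_inv_natCast_pow (fluxMean_nonneg ha hau s) (by omega), ← mul_assoc,
      ← pow_add]
    congr 2
    omega
  refine ⟨fun r _ => ha.trans_le (hau r), fun r hr => ?_, fun r hr => ?_, fun r hr => ?_, ?_⟩
  · exact mul_pos hr.1 (Real.rpow_pos_of_pos (fluxMean_pos hN1 hm0 ha hu hau hr.1.le) _)
  · refine (hasDerivAt_solMap ha hu hau r).congr_of_eventuallyEq ?_
    filter_upwards [lt_mem_nhds hr.1] with s hs using (hTu s hs.le).symm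
  · refine (hasDerivAt_pow_mul_fluxMean hN1 ha hu hau r).congr_of_eventuallyEq ?_
    filter_upwards [lt_mem_nhds hr.1] with s hs using hw s hs
  · have h1 : Continuous fun s => s ^ N * fluxMean N m u s :=
      (continuous_id.pow N).mul (continuous_fluxMean ha hu hau)
    have h2 := h1.continuousAt.tendsto.mono_left (nhdsWithin_le_nhds (s := Ioi 0) (a := 0))
    rw [zero_pow (by omega), zero_mul] at h2
    refine h2.congr' ?_
    filter_upwards [self_mem_nhdsWithin] with s hs using (hw s hs).symm

lemma eq_of_deriv_eq_of_tendsto {f g f' g' : ℝ → ℝ} {l : ℝ}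
    (hf : ∀ r ∈ Ioo 0 R, HasDerivAt f (f' r) r) (hg : ∀ r ∈ Ioo 0 R, HasDerivAt g (g' r) r)
    (he : ∀ r ∈ Ioo 0 R, f' r = g' r) (hfl : Tendsto f (𝓝[>] 0) (𝓝 l))
    (hgl : Tendsto g (𝓝[>] 0) (𝓝 l)) : EqOn f g (Ioo 0 R) := by
  intro r hr
  have h1 := nonneg_of_deriv_nonneg_of_tendsto (f := fun s => f s - g s)
    (sub_self l).ge (fun s hs => (hf s hs).sub (hg s hs))
    (fun s hs => (sub_eq_zero.2 (he s hs)).ge) (hfl.sub hgl) r hr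
  have h2 := nonneg_of_deriv_nonneg_of_tendsto (f := fun s => g s - f s)
    (sub_self l).ge (fun s hs => (hg s hs).sub (hf s hs))
    (fun s hs => (sub_eq_zero.2 (he s hs).symm).ge) (hgl.sub hfl) r hr
  linarith

lemma tendsto_nhdsGT_of_continuousOn_Ico (hR : 0 < R) (hu : ContinuousOn u (Ico 0 R)) :
    Tendsto u (𝓝[>] 0) (𝓝 (u 0)) := by
  refine (hu 0 ⟨le_rfl, hR⟩).tendsto.mono_left ?_
  rw [← nhdsWithin_Ioo_eq_nhdsGT hR]
  exact nhdsWithin_mono _ Ioo_subset_Ico_self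

/-- Freezing a solution outside `[0, R]` gives a continuous function on the line satisfying the
integral equation on `[0, R)`. -/
lemma RadialFlow.exists_solMap_eq {R' : ℝ} (hk : 1 ≤ k) (hm : (k : ℝ) < m)
    (hN : 2 * (k : ℝ) < N) (ha : 0 < a) (h : RadialFlow N k m R' u u')
    (hu : ContinuousOn u (Ico 0 R')) (h0 : u 0 = a) (hR : 0 < R) (hRR : R < R') :
    ∃ w : ℝ → ℝ, Continuous w ∧ (∀ x, a ≤ w x) ∧ EqOn w u (Ico 0 R) ∧
      ∀ x ∈ Ico 0 R, solMap N k m a w x = w x := by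
  have hN' : 2 * k < N := by exact_mod_cast hN
  have hN1 : 1 ≤ N := by omega
  have hm0 : 0 < m := one_pos.trans (one_lt_of_natCast_lt hk hm)
  have hR'0 : 0 < R' := hR.trans hRR
  have hlim := tendsto_nhdsGT_of_continuousOn_Ico hR'0 hu
  have hge : ∀ x ∈ Ico 0 R', a ≤ u x := by
    intro x hx
    rcases hx.1.eq_or_lt with rfl | hx0
    · exact h0.ge
    · rw [← h0]
      refine le_of_tendsto hlim ?_
      filter_upwards [Ioo_mem_nhdsGT hx0] with s hs
      exact h.strictMonoOn_Ioo.monotoneOn ⟨hs.1, hs.2.trans hx.2⟩ ⟨hx0, hx.2⟩ hs.2.le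
  have hclamp : ∀ x : ℝ, max 0 (min x R) ∈ Ico 0 R' := fun x =>
    ⟨le_max_left _ _, max_lt hR'0 ((min_le_right _ _).trans_lt hRR)⟩
  set w : ℝ → ℝ := fun x => u (max 0 (min x R)) with hwdef
  have hwc : Continuous w := hu.comp_continuous (by fun_prop) hclamp
  have haw : ∀ x, a ≤ w x := fun x => hge _ (hclamp x)
  have hwu : EqOn w u (Ico 0 R) := fun x hx => by
    simp only [hwdef]
    rw [min_eq_left hx.2.le, max_eq_right hx.1]
  have hsub : ∀ r ∈ Ioo 0 R, r ∈ Ioo 0 R' := fun r hr => ⟨hr.1, hr.2.trans hRR⟩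
  have hflux : EqOn (fun s => s ^ (N - k) * u' s ^ k) (fun s => s ^ N * fluxMean N m w s)
      (Ioo 0 R) := by
    refine eq_of_deriv_eq_of_tendsto (fun r hr => h.flux r (hsub r hr))
      (fun r _ => hasDerivAt_pow_mul_fluxMean hN1 ha hwc haw r) (fun r hr => ?_) h.flux_zero ?_
    · rw [hwu ⟨hr.1.le, hr.2⟩]
    · have h1 : Continuous fun s => s ^ N * fluxMean N m w s :=
        (continuous_id.pow N).mul (continuous_fluxMean ha hwc haw)
      have h2 := h1.continuousAt.tendsto.mono_left (nhdsWithin_le_nhds (s := Ioi 0) (a := 0))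
      rwa [zero_pow (by omega), zero_mul] at h2
  have hu'eq : ∀ r ∈ Ioo 0 R, u' r = r * fluxMean N m w r ^ (k : ℝ)⁻¹ := by
    intro r hr
    have h1 := hflux hr
    have h2 : r ^ N = r ^ (N - k) * r ^ k := by rw [← pow_add]; congr 1; omega
    simp only [h2, mul_assoc] at h1
    have h3 := mul_left_cancel₀ (pow_pos hr.1 _).ne' h1
    refine (pow_left_inj₀ (h.deriv_pos r (hsub r hr)).le
      (mul_nonneg hr.1.le (Real.rpow_nonneg (fluxMean_nonneg ha haw r) _))
      (by omega : k ≠ 0)).1 ?_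
    rw [h3, mul_pow, Real.rpow_inv_natCast_pow (fluxMean_nonneg ha haw r) (by omega)]
  have hEq : EqOn (solMap N k m a w) u (Ioo 0 R) := by
    refine eq_of_deriv_eq_of_tendsto (fun r _ => hasDerivAt_solMap ha hwc haw r)
      (fun r hr => h.hasDerivAt r (hsub r hr)) (fun r hr => (hu'eq r hr).symm) ?_ hlim
    have h2 := (continuous_solMap (N := N) (k := k) (m := m) ha hwc haw).continuousAt.tendsto
      |>.mono_left (nhdsWithin_le_nhds (s := Ioi 0) (a := 0))
    rw [h0]
    simpa [solMap] using h2
  refine ⟨w, hwc, haw, hwu, fun x hx => ?_⟩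
  rw [hwu hx]
  rcases hx.1.eq_or_lt with rfl | hx0
  · rw [h0]
    simp [solMap]
  · exact hEq ⟨hx0, hx.2⟩

lemma RadialFlow.eqOn_of_pos (hk : 1 ≤ k) (hm : (k : ℝ) < m) (hN : 2 * (k : ℝ) < N) (ha : 0 < a)
    (h : RadialFlow N k m R u u') (hu : ContinuousOn u (Ico 0 R)) (hu0 : u 0 = a)
    (h' : RadialFlow N k m R v v') (hv : ContinuousOn v (Ico 0 R)) (hv0 : v 0 = a) :
    EqOn u v (Ico 0 R) := by
  have hN' : 2 * k < N := by exact_mod_cast hN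
  have hm0 : 0 < m := one_pos.trans (one_lt_of_natCast_lt hk hm)
  intro x hx
  have hR : 0 < (x + R) / 2 := by linarith [hx.1, hx.2]
  have hRR : (x + R) / 2 < R := by linarith [hx.2]
  obtain ⟨w, hwc, haw, hwu, hTw⟩ := h.exists_solMap_eq hk hm hN ha hu hu0 hR hRR
  obtain ⟨z, hzc, haz, hzv, hTz⟩ := h'.exists_solMap_eq hk hm hN ha hv hv0 hR hRR
  have hx' : x ∈ Ico 0 ((x + R) / 2) := ⟨hx.1, by linarith [hx.2]⟩
  rw [← hwu hx', ← hzv hx']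
  exact eqOn_of_solMap_eq (by omega) hk hm0 ha hwc haw hzc haz hTw hTz hx'

end Picard

/-! ### Oscillation around the rupture solution -/

section Oscillation

variable {N k : ℕ} {m : ℝ} {u u' : ℝ → ℝ}

/-- The condition `m/(m-k) < q_c` says that the linearisation of the phase-plane system at its
equilibrium, whose characteristic polynomial is `λ² + (A + θ)λ + 2A`, has non-real eigenvalues. -/
lemma discriminant_neg_of_lt_qc (hk : 1 ≤ k) (hm : (k : ℝ) < m) (hN : 2 * (k : ℝ) < N)
    (h : ((m / (m - k) : ℝ) : EReal) < kHessianQc N k) :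
    (fluxExp N k m + ruptureExp k m) ^ 2 < 8 * fluxExp N k m := by
  have hk0 : (0 : ℝ) < k := by exact_mod_cast hk
  have hmk : 0 < m - k := by linarith
  have hmk' : 0 < m + k := by linarith
  have h1 : kHessianQcDenom N k * (m + k) < 2 * ((k : ℝ) + 1) ^ 2 * (m - k) := by
    unfold kHessianQc at h
    split_ifs at h with hD
    · rw [EReal.coe_lt_coe_iff] at h
      have h2 : m / (m - k) = 1 / 2 + (m + k) / (2 * (m - k)) := by
        field_simp
        ring
      rw [h2, add_lt_add_iff_left, div_lt_div_iff₀ (by positivity) hD] at h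
      linarith
    · have : 0 < 2 * ((k : ℝ) + 1) ^ 2 * (m - k) := by positivity
      nlinarith
  have hθ := ruptureExp_pos hk hm
  have hθm := ruptureExp_mul hk hm
  unfold kHessianQcDenom at h1
  set S := √((N : ℝ) * k + N - 2 * k) with hS
  have hS2 : S ^ 2 = (N : ℝ) * k + N - 2 * k := Real.sq_sqrt (by nlinarith)
  have hS0 : 0 ≤ S := Real.sqrt_nonneg _
  have hT2 : √2 ^ 2 = (2 : ℝ) := Real.sq_sqrt (by norm_num)
  have hT0 : 0 < √(2 : ℝ) := by positivity
  set T := √(2 : ℝ) with hT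
  set θ := ruptureExp k m
  have h2 : (S - T) ^ 2 < ((k : ℝ) + 1) ^ 2 * (2 - θ) := by
    have e : (((k : ℝ) + 1) ^ 2 * (2 - θ)) * (m + k) = ((k : ℝ) + 1) ^ 2 * (2 * m) := by
      linear_combination -((k : ℝ) + 1) ^ 2 * hθm
    refine lt_of_mul_lt_mul_right ?_ hmk'.le
    rw [e]
    nlinarith
  rw [fluxExp_eq hk hm]
  set ζ := ((k : ℝ) + 1) * (N - 2 * k + k * θ + θ) with hζ
  have e1 : ζ = S ^ 2 - 2 * (k : ℝ) ^ 2 + ((k : ℝ) + 1) ^ 2 * θ := by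
    rw [hζ, hS2]
    ring
  have h3 : ζ - 4 * k < 2 * T * S := by nlinarith
  have h4 : 2 * (k : ℝ) ^ 2 < S ^ 2 := by rw [hS2]; nlinarith
  have h5 : 4 * (k : ℝ) < 2 * T * S := by
    refine lt_of_pow_lt_pow_left₀ 2 (by positivity) ?_
    nlinarith
  have h6 : 0 < ζ := by rw [e1]; nlinarith [mul_pos (pow_pos (by linarith : 0 < (k : ℝ) + 1) 2) hθ]
  have h7 : (ζ - 4 * k) ^ 2 < (2 * T * S) ^ 2 := sq_lt_sq' (by linarith) h3
  have h8 : (2 * T * S) ^ 2 = 8 * S ^ 2 := by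
    rw [mul_pow, mul_pow, hT2]
    ring
  have hk1 : 0 < ((k : ℝ) + 1) ^ 2 := by positivity
  have e2 : ((k : ℝ) + 1) ^ 2 * (8 * (N - 2 * k + k * θ)) =
      8 * (S ^ 2 - 2 * (k : ℝ) ^ 2) + 8 * k * ζ := by
    rw [hS2, hζ]
    ring
  refine lt_of_mul_lt_mul_left ?_ hk1.le
  rw [e2, ← mul_pow, ← hζ]
  nlinarith

lemma exists_pos_le_quadraticForm {α β γ : ℝ} (hα : 0 < α) (hβ : 0 < β)
    (h : γ ^ 2 < 4 * α * β) :
    ∃ δ, 0 < δ ∧ ∀ x y : ℝ, δ * (x ^ 2 + y ^ 2) ≤ α * x ^ 2 + γ * (x * y) + β * y ^ 2 := by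
  set δ := (4 * α * β - γ ^ 2) / (4 * (α + β)) with hδ
  have hδ0 : 0 < δ := div_pos (by linarith) (by positivity)
  have e : δ * (4 * (α + β)) = 4 * α * β - γ ^ 2 := by
    rw [hδ]
    field_simp
  have hαδ : 0 < α - δ := by nlinarith [sq_nonneg γ]
  refine ⟨δ, hδ0, fun x y => ?_⟩
  have h1 : 0 ≤ 4 * (α - δ) * (α * x ^ 2 + γ * (x * y) + β * y ^ 2 - δ * (x ^ 2 + y ^ 2)) := by
    have h2 : 4 * (α - δ) * (α * x ^ 2 + γ * (x * y) + β * y ^ 2 - δ * (x ^ 2 + y ^ 2)) =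
        (2 * (α - δ) * x + γ * y) ^ 2 + (2 * δ * y) ^ 2 := by
      linear_combination (-y ^ 2) * e
    rw [h2]
    positivity
  have := nonneg_of_mul_nonneg_right h1 (by linarith : 0 < 4 * (α - δ))
  linarith

lemma eventually_abs_rpow_sub_le {ι : Type*} {l : Filter ι} {f : ι → ℝ} (hf : Tendsto f l (𝓝 1))
    (p : ℝ) {ε : ℝ} (hε : 0 < ε) :
    ∀ᶠ i in l, |f i ^ p - 1 - p * (f i - 1)| ≤ ε * |f i - 1| := by
  have h := (Real.hasDerivAt_rpow_const (x := 1) (p := p) (Or.inl one_ne_zero)).isLittleO.def hε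
  filter_upwards [hf.eventually h] with i hi
  simpa [mul_comm] using hi

/-- If `X` stayed away from `1`, the angle of `(X - 1, P - 1)` would be defined by
`arctan ((P - 1)/(X - 1))`; complex eigenvalues make it decrease at least linearly in `log r`,
while it is bounded. -/
lemma RadialFlow.exists_solRatio_eq_one (hk : 1 ≤ k) (hm : (k : ℝ) < m) (hN : 2 * (k : ℝ) < N)
    (h : ∀ R, RadialFlow N k m R u u')
    (hd : (fluxExp N k m + ruptureExp k m) ^ 2 < 8 * fluxExp N k m) (s₁ : ℝ) :
    ∃ s, s₁ < s ∧ solRatio N k m u s = 1 := by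
  by_contra! hcon
  obtain ⟨hX, hP⟩ := RadialFlow.ratios_tendsto_one hk hm hN h
  have hk0 : (0 : ℝ) < k := by exact_mod_cast hk
  have hm0 : 0 < m := one_pos.trans (one_lt_of_natCast_lt hk hm)
  have hA := fluxExp_pos hk hm hN
  have hθ := ruptureExp_pos hk hm
  have hθm := ruptureExp_mul hk hm
  set A := fluxExp N k m
  set θ := ruptureExp k m
  have hdisc : (A - θ) ^ 2 < 4 * (A * m) * (θ / k) := by
    have e : 4 * (A * m) * (θ / k) = 8 * A - 4 * A * θ := by
      field_simp
      linear_combination 4 * hθm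
    rw [e]
    nlinarith
  obtain ⟨δ, hδ, hQ⟩ := exists_pos_le_quadraticForm (by positivity : 0 < A * m)
    (by positivity : 0 < θ / k) hdisc
  set ε := δ / (2 * (A + θ)) with hε
  have hε0 : 0 < ε := by positivity
  have hεe : ε * (2 * (A + θ)) = δ := by
    rw [hε]
    field_simp
  obtain ⟨s₂, hs₂⟩ := eventually_atTop.1 ((eventually_abs_rpow_sub_le hX (-m) hε0).and
    (eventually_abs_rpow_sub_le hP (k : ℝ)⁻¹ hε0))
  set s₀ := max 1 (max (s₁ + 1) s₂)
  have hs0 : 1 ≤ s₀ := le_max_left _ _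
  have hs1 : s₁ < s₀ := (lt_add_one s₁).trans_le ((le_max_left _ _).trans (le_max_right _ _))
  have hs2 : s₂ ≤ s₀ := (le_max_right _ _).trans (le_max_right _ _)
  set X := solRatio N k m u
  set P := fluxRatio N k m u'
  have key : ∀ r ∈ Ici s₀, ∃ d, HasDerivAt
      (fun r => Real.arctan ((P r - 1) / (X r - 1)) + δ / 2 * Real.log r) d r ∧ d ≤ 0 := by
    intro r hr
    have hr0 : 0 < r := by linarith [mem_Ici.1 hr]
    have hrI : r ∈ Ioo 0 (r + 1) := ⟨hr0, by linarith⟩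
    have hne : X r - 1 ≠ 0 := sub_ne_zero.2 (hcon r (hs1.trans_le hr))
    have dX := (h (r + 1)).hasDerivAt_solRatio hk hm hN hrI
    have dP := (h (r + 1)).hasDerivAt_fluxRatio hk hm hN hrI
    have d1 := (((dP.sub_const 1).div (dX.sub_const 1) hne).arctan).add
      ((Real.hasDerivAt_log hr0.ne').const_mul (δ / 2))
    refine ⟨_, d1, ?_⟩
    obtain ⟨e1, e2⟩ := hs₂ r (hs2.trans hr)
    change 1 / (1 + ((P r - 1) / (X r - 1)) ^ 2) * ((A * (X r ^ (-m) - P r) / r * (X r - 1) -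
      (P r - 1) * (θ * (P r ^ (k : ℝ)⁻¹ - X r) / r)) / (X r - 1) ^ 2) + δ / 2 * r⁻¹ ≤ 0
    change |X r ^ (-m) - 1 - -m * (X r - 1)| ≤ ε * |X r - 1| at e1
    change |P r ^ (k : ℝ)⁻¹ - 1 - (k : ℝ)⁻¹ * (P r - 1)| ≤ ε * |P r - 1| at e2
    have f1 : (X r ^ (-m) - 1 - -m * (X r - 1)) * (X r - 1) ≤ ε * (X r - 1) ^ 2 := by
      calc _ ≤ |X r ^ (-m) - 1 - -m * (X r - 1)| * |X r - 1| := by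
            rw [← abs_mul]; exact le_abs_self _
        _ ≤ ε * |X r - 1| * |X r - 1| := mul_le_mul_of_nonneg_right e1 (abs_nonneg _)
        _ = ε * (X r - 1) ^ 2 := by rw [mul_assoc, abs_mul_abs_self, sq]
    have f2 : -(P r ^ (k : ℝ)⁻¹ - 1 - (k : ℝ)⁻¹ * (P r - 1)) * (P r - 1) ≤
        ε * (P r - 1) ^ 2 := by
      calc _ ≤ |P r ^ (k : ℝ)⁻¹ - 1 - (k : ℝ)⁻¹ * (P r - 1)| * |P r - 1| := by
            rw [← abs_neg, ← abs_mul]; exact le_abs_self _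
        _ ≤ ε * |P r - 1| * |P r - 1| := mul_le_mul_of_nonneg_right e2 (abs_nonneg _)
        _ = ε * (P r - 1) ^ 2 := by rw [mul_assoc, abs_mul_abs_self, sq]
    have hq := hQ (X r - 1) (P r - 1)
    generalize X r ^ (-m) = Xm at *
    generalize P r ^ (k : ℝ)⁻¹ = Y at *
    set ξ := X r - 1 with hξ
    set π := P r - 1 with hπ
    have hXr : X r = ξ + 1 := by ring
    have hPr : P r = π + 1 := by ring
    rw [hXr, hPr]
    have hs : 0 < ξ ^ 2 + π ^ 2 := by positivity
    have hnum : A * (Xm - (π + 1)) * ξ - π * (θ * (Y - (ξ + 1))) ≤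
        -(δ / 2) * (ξ ^ 2 + π ^ 2) := by
      have e : A * (Xm - (π + 1)) * ξ - π * (θ * (Y - (ξ + 1))) =
          -(A * m * ξ ^ 2 + (A - θ) * (ξ * π) + θ / k * π ^ 2) +
          A * ((Xm - 1 - -m * ξ) * ξ) + θ * (-(Y - 1 - (k : ℝ)⁻¹ * π) * π) := by
        field_simp
        ring
      rw [e]
      have g1 := mul_le_mul_of_nonneg_left f1 hA.le
      have g2 := mul_le_mul_of_nonneg_left f2 hθ.le
      have g3 : A * (ε * ξ ^ 2) + θ * (ε * π ^ 2) ≤ δ / 2 * (ξ ^ 2 + π ^ 2) := by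
        rw [← hεe]
        nlinarith [mul_nonneg (mul_nonneg hε0.le hA.le) (sq_nonneg π),
          mul_nonneg (mul_nonneg hε0.le hθ.le) (sq_nonneg ξ)]
      linarith
    have e : 1 / (1 + (π / ξ) ^ 2) * ((A * (Xm - (π + 1)) / r * ξ -
        π * (θ * (Y - (ξ + 1)) / r)) / ξ ^ 2) + δ / 2 * r⁻¹ =
        ((A * (Xm - (π + 1)) * ξ - π * (θ * (Y - (ξ + 1)))) + δ / 2 * (ξ ^ 2 + π ^ 2)) /
          (r * (ξ ^ 2 + π ^ 2)) := by
      field_simp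
    rw [e]
    exact div_nonpos_of_nonpos_of_nonneg (by linarith) (by positivity)
  have hanti : AntitoneOn
      (fun r => Real.arctan ((P r - 1) / (X r - 1)) + δ / 2 * Real.log r) (Ici s₀) := by
    refine antitoneOn_of_deriv_nonpos (convex_Ici s₀) (fun r hr => ?_) (fun r hr => ?_)
      (fun r hr => ?_)
    · obtain ⟨d, hd, -⟩ := key r hr
      exact hd.continuousAt.continuousWithinAt
    · obtain ⟨d, hd, -⟩ := key r (interior_subset hr)
      exact hd.differentiableAt.differentiableWithinAt
    · obtain ⟨d, hd, hd'⟩ := key r (interior_subset hr)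
      rw [hd.deriv]
      exact hd'
  set B := Real.arctan ((P s₀ - 1) / (X s₀ - 1)) + δ / 2 * Real.log s₀
  have hlog : Tendsto (fun r => δ / 2 * Real.log r) atTop atTop :=
    Real.tendsto_log_atTop.const_mul_atTop (by positivity)
  obtain ⟨r, hr, hr'⟩ := ((hlog.eventually_gt_atTop (B + Real.pi / 2)).and
    (eventually_ge_atTop s₀)).exists
  have h1 := hanti self_mem_Ici hr' hr'
  have h2 := Real.neg_pi_div_two_lt_arctan ((P r - 1) / (X r - 1))
  change Real.arctan ((P r - 1) / (X r - 1)) + δ / 2 * Real.log r ≤ B at h1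
  linarith

end Oscillation

/-! ### Scaling and convergence to the rupture solution -/

/-- The second derivative of a solution is `Cθ r^{θ-2}` times this function of the ratios
`X, P`. -/
noncomputable def secondDerivRatio (N k : ℕ) (m X P : ℝ) : ℝ :=
  (ruptureExp k m - 1) * P ^ (k : ℝ)⁻¹ +
    fluxExp N k m * (k : ℝ)⁻¹ * P ^ ((k : ℝ)⁻¹ - 1) * (X ^ (-m) - P)

section Scaling

variable {N k : ℕ} {m R : ℝ} {u u' f : ℝ → ℝ}

lemma RadialFlow.strictMonoOn (h : RadialFlow N k m R u u') (hu : ContinuousOn u (Ico 0 R)) :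
    StrictMonoOn u (Ico 0 R) := by
  refine strictMonoOn_of_deriv_pos (convex_Ico 0 R) hu ?_
  rw [interior_Ico]
  intro r hr
  rw [(h.hasDerivAt r hr).deriv]
  exact h.deriv_pos r hr

lemma eq_mul_solRatio (hk : 1 ≤ k) (hm : (k : ℝ) < m) (hN : 2 * (k : ℝ) < N) {r : ℝ} (hr : 0 < r) :
    u r = ruptureCoeff N k m * r ^ ruptureExp k m * solRatio N k m u r := by
  have hC := ruptureCoeff_pos hk hm hN
  have := Real.rpow_pos_of_pos hr (ruptureExp k m)
  unfold solRatio
  field_simp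

lemma eq_mul_fluxRatio_rpow (hk : 1 ≤ k) (hm : (k : ℝ) < m) (hN : 2 * (k : ℝ) < N) {r : ℝ}
    (hr : 0 < r) (hu : 0 ≤ u' r) :
    u' r = ruptureCoeff N k m * ruptureExp k m * r ^ (ruptureExp k m - 1) *
      fluxRatio N k m u' r ^ (k : ℝ)⁻¹ := by
  have hC := ruptureCoeff_pos hk hm hN
  have hθ := ruptureExp_pos hk hm
  have := Real.rpow_pos_of_pos hr (ruptureExp k m - 1)
  rw [fluxRatio_rpow hk hm hN hr hu]
  field_simp

lemma RadialFlow.deriv_eqOn (hk : 1 ≤ k) (hm : (k : ℝ) < m) (hN : 2 * (k : ℝ) < N)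
    (h : RadialFlow N k m R u u') (hf : EqOn f u (Ioo 0 R)) :
    EqOn (deriv f) (fun r => ruptureCoeff N k m * ruptureExp k m * r ^ (ruptureExp k m - 1) *
      fluxRatio N k m u' r ^ (k : ℝ)⁻¹) (Ioo 0 R) := by
  intro r hr
  have h1 : f =ᶠ[𝓝 r] u := by
    filter_upwards [isOpen_Ioo.mem_nhds hr] with s hs using hf hs
  rw [h1.deriv_eq, (h.hasDerivAt r hr).deriv]
  exact eq_mul_fluxRatio_rpow hk hm hN hr.1 (h.deriv_pos r hr).le

lemma RadialFlow.iteratedDeriv_two_eqOn (hk : 1 ≤ k) (hm : (k : ℝ) < m) (hN : 2 * (k : ℝ) < N)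
    (h : RadialFlow N k m R u u') (hf : EqOn f u (Ioo 0 R)) :
    EqOn (iteratedDeriv 2 f) (fun r => ruptureCoeff N k m * ruptureExp k m *
      r ^ (ruptureExp k m - 2) * secondDerivRatio N k m (solRatio N k m u r)
        (fluxRatio N k m u' r)) (Ioo 0 R) := by
  intro r hr
  have h1 : deriv f =ᶠ[𝓝 r] fun r => ruptureCoeff N k m * ruptureExp k m *
      r ^ (ruptureExp k m - 1) * fluxRatio N k m u' r ^ (k : ℝ)⁻¹ := by
    filter_upwards [isOpen_Ioo.mem_nhds hr] with s hs using h.deriv_eqOn hk hm hN hf hs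
  have hP := fluxRatio_pos hk hm hN hr.1 (h.deriv_pos r hr)
  have h2 := ((Real.hasDerivAt_rpow_const (p := ruptureExp k m - 1) (Or.inl hr.1.ne')).const_mul
    (ruptureCoeff N k m * ruptureExp k m)).mul
    ((h.hasDerivAt_fluxRatio hk hm hN hr).rpow_const (p := (k : ℝ)⁻¹) (Or.inl hP.ne'))
  rw [iteratedDeriv_succ, iteratedDeriv_one, h1.deriv_eq]
  refine h2.deriv.trans ?_
  have hr0 := hr.1.ne'
  have e1 : ruptureExp k m - 1 - 1 = ruptureExp k m - 2 := by ring
  have e2 : r ^ (ruptureExp k m - 1) = r ^ (ruptureExp k m - 2) * r := by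
    rw [← Real.rpow_add_one hr0]
    congr 1
    ring
  rw [e1, e2]
  unfold secondDerivRatio
  field_simp

lemma solRatio_kHessianRupture (hk : 1 ≤ k) (hm : (k : ℝ) < m) (hN : 2 * (k : ℝ) < N) {r : ℝ}
    (hr : 0 < r) : solRatio N k m (kHessianRupture N k m) r = 1 :=
  div_self (mul_pos (ruptureCoeff_pos hk hm hN) (Real.rpow_pos_of_pos hr _)).ne'

lemma fluxRatio_kHessianRupture (hk : 1 ≤ k) (hm : (k : ℝ) < m) (hN : 2 * (k : ℝ) < N) {r : ℝ}
    (hr : 0 < r) : fluxRatio N k m (fun r => ruptureCoeff N k m * ruptureExp k m *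
      r ^ (ruptureExp k m - 1)) r = 1 := by
  have hC := ruptureCoeff_pos hk hm hN
  have hθ := ruptureExp_pos hk hm
  have h0 := Real.rpow_pos_of_pos hr (ruptureExp k m - 1)
  have hrI : r ∈ Ioo 0 (r + 1) := ⟨hr, by linarith⟩
  have hflow := radialFlow_kHessianRupture hk hm hN (r + 1)
  have hpos := fluxRatio_pos (u' := fun r => ruptureCoeff N k m * ruptureExp k m *
    r ^ (ruptureExp k m - 1)) hk hm hN hr (hflow.deriv_pos r hrI)
  have h1 := fluxRatio_rpow (u' := fun r => ruptureCoeff N k m * ruptureExp k m *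
    r ^ (ruptureExp k m - 1)) hk hm hN hr (hflow.deriv_pos r hrI).le
  rw [div_self (by positivity)] at h1
  have hk0 : (k : ℝ)⁻¹ ≠ 0 := inv_ne_zero (Nat.cast_ne_zero.2 (by omega))
  exact (Real.rpow_left_inj hpos.le zero_le_one hk0).1 (h1.trans (Real.one_rpow _).symm)

/-- The equation is invariant under `u ↦ σ^θ u(·/σ)`. -/
lemma RadialFlow.scale (hk : 1 ≤ k) (hm : (k : ℝ) < m) (hN : 2 * (k : ℝ) < N)
    (h : ∀ R, RadialFlow N k m R u u') {σ : ℝ} (hσ : 0 < σ) (R : ℝ) :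
    RadialFlow N k m R (fun r => σ ^ ruptureExp k m * u (r / σ))
      (fun r => σ ^ ruptureExp k m / σ * u' (r / σ)) := by
  have hN' : 2 * k < N := by exact_mod_cast hN
  set a := σ ^ ruptureExp k m with ha
  have ha0 : 0 < a := Real.rpow_pos_of_pos hσ _
  have hI : ∀ r ∈ Ioo 0 R, r / σ ∈ Ioo 0 (R / σ) := fun r hr =>
    ⟨div_pos hr.1 hσ, div_lt_div_of_pos_right hr.2 hσ⟩
  have hflux : (fun s => s ^ (N - k) * (a / σ * u' (s / σ)) ^ k) = fun s =>
      σ ^ (N - k) * (a / σ) ^ k * ((s / σ) ^ (N - k) * u' (s / σ) ^ k) := by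
    ext s
    rw [mul_pow, div_pow s σ]
    field_simp
  refine ⟨fun r hr => mul_pos ha0 ((h _).pos _ (hI r hr)),
    fun r hr => mul_pos (div_pos ha0 hσ) ((h _).deriv_pos _ (hI r hr)), fun r hr => ?_,
    fun r hr => ?_, ?_⟩
  · exact ((((h _).hasDerivAt _ (hI r hr)).comp r
      ((hasDerivAt_id r).div_const σ)).const_mul a).congr_deriv (by ring)
  · rw [hflux]
    refine ((((h _).flux _ (hI r hr)).comp r ((hasDerivAt_id r).div_const σ)).const_mul
      (σ ^ (N - k) * (a / σ) ^ k)).congr_deriv ?_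
    have hu := (h _).pos _ (hI r hr)
    have e1 : a ^ k * a ^ m = σ ^ (2 * k) := by
      rw [← Real.rpow_natCast a, ← Real.rpow_add ha0, ha, ← Real.rpow_mul hσ.le,
        add_comm (k : ℝ) m, ruptureExp_mul hk hm, ← Real.rpow_natCast]
      push_cast
      rfl
    have e2 : a ^ (-m) = a ^ k / σ ^ (2 * k) := by
      rw [Real.rpow_neg ha0.le, ← e1]
      field_simp
    have e3 : σ ^ N = σ ^ (N - k) * σ ^ k := by rw [← pow_add]; congr 1; omega
    have e4 : σ ^ N = σ ^ (N - 1) * σ := by rw [← pow_succ]; congr 1; omega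
    rw [Real.mul_rpow ha0.le hu.le, e2, div_pow, div_pow, pow_mul', sq]
    field_simp
    linear_combination r ^ (N - 1) * (e4 - e3)
  · rw [hflux]
    have h1 : Tendsto (fun s : ℝ => s / σ) (𝓝[>] 0) (𝓝[>] 0) := by
      refine tendsto_nhdsWithin_iff.2 ⟨?_, ?_⟩
      · have : Tendsto (fun s : ℝ => s / σ) (𝓝 0) (𝓝 (0 / σ)) := tendsto_id.div_const σ
        rw [zero_div] at this
        exact this.mono_left nhdsWithin_le_nhds
      · filter_upwards [self_mem_nhdsWithin] with s hs using div_pos hs hσ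
    have h2 := ((h 1).flux_zero.comp h1).const_mul (σ ^ (N - k) * (a / σ) ^ k)
    rwa [mul_zero] at h2

lemma solRatio_scale {σ : ℝ} (hσ : 0 < σ) {r : ℝ} (hr : 0 < r) :
    solRatio N k m (fun r => σ ^ ruptureExp k m * u (r / σ)) r = solRatio N k m u (r / σ) := by
  have h1 := Real.rpow_pos_of_pos hσ (ruptureExp k m)
  unfold solRatio
  rw [Real.div_rpow hr.le hσ.le]
  field_simp

lemma fluxRatio_scale (hk : 1 ≤ k) (hm : (k : ℝ) < m) (hN : 2 * (k : ℝ) < N) {σ : ℝ}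
    (hσ : 0 < σ) {r : ℝ} (hr : 0 < r) :
    fluxRatio N k m (fun r => σ ^ ruptureExp k m / σ * u' (r / σ)) r =
      fluxRatio N k m u' (r / σ) := by
  have hN' : 2 * k < N := by exact_mod_cast hN
  have h1 := Real.rpow_pos_of_pos hσ (ruptureExp k m)
  have h2 := Real.rpow_pos_of_pos hσ (fluxExp N k m)
  have h3 := Real.rpow_pos_of_pos hr (fluxExp N k m)
  have hC := ruptureCoeff_pos hk hm hN
  have hθ := ruptureExp_pos hk hm
  have e : σ ^ fluxExp N k m = σ ^ (N - k) * (σ ^ ruptureExp k m / σ) ^ k := by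
    rw [← Real.rpow_sub_one hσ.ne', ← Real.rpow_natCast, ← Real.rpow_natCast,
      ← Real.rpow_mul hσ.le, ← Real.rpow_add hσ, Nat.cast_sub (by omega), fluxExp_eq hk hm]
    congr 1
    ring
  unfold fluxRatio
  rw [Real.div_rpow hr.le hσ.le, e, mul_pow, div_pow r σ]
  field_simp

/-- Profiles `r ↦ g(r) h(r/σ)` converge locally uniformly away from the origin as `σ → 0⁺`
when `h` has a limit at infinity. -/
lemma tendstoUniformlyOn_mul_comp_div {ι : Type*} {l : Filter ι} {σ : ι → ℝ}
    (hσ : Tendsto σ l (𝓝[>] 0)) {g h : ℝ → ℝ} {c : ℝ} (hh : Tendsto h atTop (𝓝 c)) {K : Set ℝ}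
    (hK : IsCompact K) (hK0 : K ⊆ Ioi 0) (hg : ContinuousOn g K) :
    TendstoUniformlyOn (fun i r => g r * h (r / σ i)) (fun r => g r * c) l K := by
  rcases K.eq_empty_or_nonempty with rfl | hne
  · exact tendstoUniformlyOn_empty
  obtain ⟨δ, hδK, hδ⟩ := hK.exists_isLeast hne
  have hδ0 : 0 < δ := hK0 hδK
  obtain ⟨B, hB⟩ := hK.exists_bound_of_continuousOn hg
  have hB0 : 0 ≤ B := (norm_nonneg _).trans (hB δ hδK)
  rw [Metric.tendstoUniformlyOn_iff]
  intro ε hε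
  obtain ⟨S, hS⟩ := eventually_atTop.1
    (Metric.tendsto_nhds.1 hh (ε / (B + 1)) (by positivity))
  have h1 : Tendsto (fun i => δ * (σ i)⁻¹) l atTop :=
    (tendsto_inv_nhdsGT_zero.comp hσ).const_mul_atTop hδ0
  filter_upwards [h1.eventually_ge_atTop S, hσ.eventually self_mem_nhdsWithin] with i hi hi0 r hr
  have h2 : S ≤ r / σ i := by
    rw [← div_eq_mul_inv] at hi
    exact hi.trans (div_le_div_of_nonneg_right (hδ hr) (le_of_lt hi0))
  have h3 := hS _ h2
  rw [dist_comm, Real.dist_eq, ← mul_sub, abs_mul]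
  rw [Real.dist_eq, lt_div_iff₀ (by positivity)] at h3
  have h4 := hB r hr
  rw [Real.norm_eq_abs] at h4
  calc |g r| * |h (r / σ i) - c| ≤ B * |h (r / σ i) - c| :=
        mul_le_mul_of_nonneg_right h4 (abs_nonneg _)
    _ ≤ |h (r / σ i) - c| * (B + 1) := by nlinarith [abs_nonneg (h (r / σ i) - c)]
    _ < ε := h3

/-- The scale `σ = a^{1/θ}` of the solution with central value `a`. -/
noncomputable def solScale (k : ℕ) (m a : ℝ) : ℝ := a ^ (ruptureExp k m)⁻¹

lemma solScale_pos (k : ℕ) (m : ℝ) {a : ℝ} (ha : 0 < a) : 0 < solScale k m a :=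
  Real.rpow_pos_of_pos ha _

lemma solScale_rpow (hk : 1 ≤ k) (hm : (k : ℝ) < m) {a : ℝ} (ha : 0 < a) :
    solScale k m a ^ ruptureExp k m = a :=
  Real.rpow_inv_rpow ha.le (ruptureExp_pos hk hm).ne'

lemma tendsto_solScale (hk : 1 ≤ k) (hm : (k : ℝ) < m) :
    Tendsto (solScale k m) (𝓝[>] 0) (𝓝[>] 0) := by
  have hθ := inv_pos.2 (ruptureExp_pos hk hm)
  refine tendsto_nhdsWithin_iff.2 ⟨?_, ?_⟩
  · have h := (Real.continuous_rpow_const hθ.le).tendsto 0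
    rw [Real.zero_rpow hθ.ne'] at h
    exact h.mono_left nhdsWithin_le_nhds
  · filter_upwards [self_mem_nhdsWithin] with a ha using solScale_pos k m ha

/-- The increasing solution with central value `a`, in terms of the one with central value `1`. -/
lemma RadialFlow.scale_solScale (hk : 1 ≤ k) (hm : (k : ℝ) < m) (hN : 2 * (k : ℝ) < N)
    (h : ∀ R, RadialFlow N k m R u u') {a : ℝ} (ha : 0 < a) (R : ℝ) :
    RadialFlow N k m R (fun r => a * u (r / solScale k m a))
      (fun r => a / solScale k m a * u' (r / solScale k m a)) := by
  have := RadialFlow.scale hk hm hN h (solScale_pos k m ha) R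
  rwa [solScale_rpow hk hm ha] at this

lemma kHessianRupture_scale (hk : 1 ≤ k) (hm : (k : ℝ) < m) {a r : ℝ} (ha : 0 < a)
    (hr : 0 ≤ r) :
    a * kHessianRupture N k m (r / solScale k m a) = kHessianRupture N k m r := by
  have hσ := solScale_pos k m ha
  rw [kHessianRupture_eq, kHessianRupture_eq, Real.div_rpow hr hσ.le, solScale_rpow hk hm ha]
  field_simp

lemma exists_abs_sub_kHessianRupture_le (hk : 1 ≤ k) (hm : (k : ℝ) < m) (hN : 2 * (k : ℝ) < N)
    (h : ∀ R, RadialFlow N k m R u u') (hu : Continuous u) {ε : ℝ} (hε : 0 < ε) :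
    ∃ M, 0 < M ∧ ∀ s, 0 ≤ s → |u s - kHessianRupture N k m s| ≤ ε * s ^ ruptureExp k m + M := by
  have hC := ruptureCoeff_pos hk hm hN
  have hθ := ruptureExp_pos hk hm
  obtain ⟨hX, -⟩ := RadialFlow.ratios_tendsto_one hk hm hN h
  obtain ⟨S, hS⟩ := eventually_atTop.1
    (Metric.tendsto_nhds.1 hX (ε / ruptureCoeff N k m) (by positivity))
  have hc : Continuous fun s => u s - kHessianRupture N k m s :=
    hu.sub (continuous_const.mul (Real.continuous_rpow_const hθ.le))
  obtain ⟨M, hM⟩ := (isCompact_Icc (a := 0) (b := max S 1)).exists_bound_of_continuousOn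
    hc.continuousOn
  refine ⟨|M| + 1, by positivity, fun s hs => ?_⟩
  have hsθ := Real.rpow_nonneg hs (ruptureExp k m)
  rcases le_or_gt s (max S 1) with hsS | hsS
  · have h1 := hM s ⟨hs, hsS⟩
    rw [Real.norm_eq_abs] at h1
    have := le_abs_self M
    have := mul_nonneg hε.le hsθ
    linarith
  · have h1 := hS s ((le_max_left _ _).trans hsS.le)
    have hs0 : 0 < s := (one_pos.trans_le (le_max_right _ _)).trans hsS
    rw [Real.dist_eq, lt_div_iff₀ hC] at h1
    rw [eq_mul_solRatio (u := u) hk hm hN hs0, kHessianRupture_eq]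
    have e : ruptureCoeff N k m * s ^ ruptureExp k m * solRatio N k m u s -
        ruptureCoeff N k m * s ^ ruptureExp k m =
        s ^ ruptureExp k m * ((solRatio N k m u s - 1) * ruptureCoeff N k m) := by ring
    rw [e, abs_mul, abs_mul, abs_of_nonneg hsθ, abs_of_pos hC]
    have h2 := mul_le_mul_of_nonneg_left h1.le hsθ
    have := abs_nonneg M
    linarith

/-- Convergence up to the origin, where only the solutions themselves converge. -/
lemma tendstoCLoc_zero_of_eqOn_scale (hk : 1 ≤ k) (hm : (k : ℝ) < m) (hN : 2 * (k : ℝ) < N)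
    (h : ∀ R, RadialFlow N k m R u u') (hu : Continuous u) {U : ℝ → ℝ → ℝ}
    (hU : ∀ a ∈ Ioo (0 : ℝ) 1, EqOn (U a) (fun r => a * u (r / solScale k m a)) (Ico 0 R)) :
    TendstoCLoc 0 (Ico 0 R) U (kHessianRupture N k m) := by
  intro i hi K hK _
  obtain rfl : i = 0 := by omega
  simp only [iteratedDeriv_zero]
  have hθ := ruptureExp_pos hk hm
  rw [Metric.tendstoUniformlyOn_iff]
  intro ε hε
  set D := |R| ^ ruptureExp k m + 1 with hD
  have hD0 : 0 < D := by positivity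
  obtain ⟨M, hM0, hM⟩ := exists_abs_sub_kHessianRupture_le hk hm hN h hu
    (by positivity : 0 < ε / (2 * D))
  filter_upwards [Ioo_mem_nhdsGT one_pos, Ioo_mem_nhdsGT (by positivity : 0 < ε / (2 * M))]
    with a ha ha' r hr
  have hrR := hK hr
  have hσ := solScale_pos k m ha.1
  have h1 := hM (r / solScale k m a) (div_nonneg hrR.1 hσ.le)
  rw [hU a ha hrR, ← kHessianRupture_scale hk hm ha.1 hrR.1, dist_comm, Real.dist_eq, ← mul_sub,
    abs_mul, abs_of_pos ha.1]
  rw [Real.div_rpow hrR.1 hσ.le, solScale_rpow hk hm ha.1] at h1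
  have h2 : r ^ ruptureExp k m < D :=
    (Real.rpow_le_rpow hrR.1 (hrR.2.le.trans (le_abs_self R)) hθ.le).trans_lt (lt_add_one _)
  have h3 : a * M < ε / 2 := by
    have := (lt_div_iff₀ (by positivity)).1 ha'.2
    linarith
  have h4 : ε / (2 * D) * r ^ ruptureExp k m ≤ ε / 2 := by
    rw [div_mul_eq_mul_div, div_le_div_iff₀ (by positivity) two_pos]
    nlinarith
  have ha0 := ha.1
  calc a * |u (r / solScale k m a) - kHessianRupture N k m (r / solScale k m a)|
      ≤ a * (ε / (2 * D) * (r ^ ruptureExp k m / a) + M) :=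
        mul_le_mul_of_nonneg_left h1 ha.1.le
    _ = ε / (2 * D) * r ^ ruptureExp k m + a * M := by field_simp
    _ < ε := by linarith

lemma tendstoCLoc_two_of_eqOn_scale (hk : 1 ≤ k) (hm : (k : ℝ) < m) (hN : 2 * (k : ℝ) < N)
    (h : ∀ R, RadialFlow N k m R u u') {U : ℝ → ℝ → ℝ}
    (hU : ∀ a ∈ Ioo (0 : ℝ) 1, EqOn (U a) (fun r => a * u (r / solScale k m a)) (Ioo 0 R)) :
    TendstoCLoc 2 (Ioo 0 R) U (kHessianRupture N k m) := by
  intro i hi K hK hKc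
  obtain ⟨hX, hP⟩ := RadialFlow.ratios_tendsto_one hk hm hN h
  have hK0 : K ⊆ Ioi 0 := fun r hr => (hK hr).1
  have hσ := tendsto_solScale hk hm
  have hcont : ∀ c p : ℝ, ContinuousOn (fun r : ℝ => c * r ^ p) K := fun c p =>
    continuousOn_const.mul (continuousOn_id.rpow_const fun r hr => Or.inl (hK0 hr).ne')
  have hstar := radialFlow_kHessianRupture hk hm hN R
  have hflow := fun (a : ℝ) (ha : a ∈ Ioo (0 : ℝ) 1) =>
    RadialFlow.scale_solScale hk hm hN h ha.1 R
  have hXs : ∀ a ∈ Ioo (0 : ℝ) 1, ∀ r, 0 < r →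
      solRatio N k m (fun r => a * u (r / solScale k m a)) r =
        solRatio N k m u (r / solScale k m a) := by
    intro a ha r hr
    have := solRatio_scale (N := N) (k := k) (m := m) (u := u)
      (solScale_pos k m ha.1) hr
    rwa [solScale_rpow hk hm ha.1] at this
  have hPs : ∀ a ∈ Ioo (0 : ℝ) 1, ∀ r, 0 < r →
      fluxRatio N k m (fun r => a / solScale k m a * u' (r / solScale k m a)) r =
        fluxRatio N k m u' (r / solScale k m a) := by
    intro a ha r hr
    have := fluxRatio_scale (u' := u') hk hm hN
      (solScale_pos k m ha.1) hr
    rwa [solScale_rpow hk hm ha.1] at this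
  interval_cases i
  · simp only [iteratedDeriv_zero]
    refine ((tendstoUniformlyOn_mul_comp_div hσ hX hKc hK0
      (hcont (ruptureCoeff N k m) (ruptureExp k m))).congr ?_).congr_right fun r hr => ?_
    · filter_upwards [Ioo_mem_nhdsGT one_pos] with a ha r hr
      have h1 := eq_mul_solRatio (u := fun r => a * u (r / solScale k m a)) hk hm hN (hK0 hr)
      rw [hXs a ha r (hK0 hr)] at h1
      exact h1.symm.trans (hU a ha (hK hr)).symm
    · simp only
      rw [mul_one, kHessianRupture_eq]
  · simp only [iteratedDeriv_one]
    have hY := hP.rpow_const (p := (k : ℝ)⁻¹) (Or.inl one_ne_zero)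
    refine ((tendstoUniformlyOn_mul_comp_div hσ hY hKc hK0
      (hcont (ruptureCoeff N k m * ruptureExp k m) (ruptureExp k m - 1))).congr ?_).congr_right
      fun r hr => ?_
    · filter_upwards [Ioo_mem_nhdsGT one_pos] with a ha r hr
      have h1 := (hflow a ha).deriv_eqOn hk hm hN (hU a ha) (hK hr)
      simp only [hPs a ha r (hK0 hr)] at h1
      exact h1.symm
    · have h1 := hstar.deriv_eqOn hk hm hN (fun _ _ => rfl) (hK hr)
      simp only [fluxRatio_kHessianRupture hk hm hN (hK0 hr)] at h1
      exact h1.symm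
  · have hH : Tendsto (fun s => secondDerivRatio N k m (solRatio N k m u s)
        (fluxRatio N k m u' s)) atTop (𝓝 (secondDerivRatio N k m 1 1)) :=
      ((hP.rpow_const (Or.inl one_ne_zero)).const_mul _).add
        (((hP.rpow_const (Or.inl one_ne_zero)).const_mul _).mul
          ((hX.rpow_const (Or.inl one_ne_zero)).sub hP))
    refine ((tendstoUniformlyOn_mul_comp_div hσ hH hKc hK0
      (hcont (ruptureCoeff N k m * ruptureExp k m) (ruptureExp k m - 2))).congr ?_).congr_right
      fun r hr => ?_
    · filter_upwards [Ioo_mem_nhdsGT one_pos] with a ha r hr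
      have h1 := (hflow a ha).iteratedDeriv_two_eqOn hk hm hN (hU a ha) (hK hr)
      simp only [hPs a ha r (hK0 hr), hXs a ha r (hK0 hr)] at h1
      exact h1.symm
    · have h1 := hstar.iteratedDeriv_two_eqOn hk hm hN (fun _ _ => rfl) (hK hr)
      simp only [fluxRatio_kHessianRupture hk hm hN (hK0 hr),
        solRatio_kHessianRupture hk hm hN (hK0 hr)] at h1
      exact h1.symm

/-- Rescaling moves the infinitely many intersections of the global solution with the rupture
solution into any neighbourhood of the origin. -/
lemma tendsto_zeroNumber (hk : 1 ≤ k) (hm : (k : ℝ) < m) (hN : 2 * (k : ℝ) < N)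
    (h : ∀ R, RadialFlow N k m R u u')
    (hd : (fluxExp N k m + ruptureExp k m) ^ 2 < 8 * fluxExp N k m) {U : ℝ → ℝ → ℝ}
    (hU : ∀ a ∈ Ioo (0 : ℝ) 1, EqOn (U a) (fun r => a * u (r / solScale k m a)) (Ioo 0 R))
    {ρ : ℝ} (hρ : ρ ∈ Ioo 0 R) :
    Tendsto (fun a => zeroNumber (Ioo 0 ρ) (fun r => U a r - kHessianRupture N k m r))
      (𝓝[>] 0) (𝓝 ⊤) := by
  rw [ENat.tendsto_nhds_top_iff_natCast_lt]
  intro n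
  have hinf : {s : ℝ | 0 < s ∧ solRatio N k m u s = 1}.Infinite := by
    refine infinite_of_not_bddAbove fun ⟨b, hb⟩ => ?_
    obtain ⟨s, hs, hs'⟩ := RadialFlow.exists_solRatio_eq_one hk hm hN h hd (max b 0)
    exact absurd (hb ⟨(le_max_right _ _).trans_lt hs, hs'⟩)
      (not_le.2 ((le_max_left _ _).trans_lt hs))
  obtain ⟨F, hF, hFn⟩ := hinf.exists_subset_card_eq (n + 1)
  obtain ⟨B, hB⟩ := F.bddAbove
  have hσ := tendsto_solScale hk hm
  have h1 : Tendsto (fun a => ρ * (solScale k m a)⁻¹) (𝓝[>] 0) atTop :=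
    (tendsto_inv_nhdsGT_zero.comp hσ).const_mul_atTop hρ.1
  filter_upwards [Ioo_mem_nhdsGT one_pos, h1.eventually_gt_atTop B] with a ha haB
  have hσ0 := solScale_pos k m ha.1
  have hinj : Function.Injective fun s : ℝ => solScale k m a * s :=
    mul_right_injective₀ hσ0.ne'
  have hsub : (fun s : ℝ => solScale k m a * s) '' (F : Set ℝ) ⊆
      {r ∈ Ioo 0 ρ | U a r - kHessianRupture N k m r = 0} := by
    rintro _ ⟨s, hs, rfl⟩
    obtain ⟨hs0, hs1⟩ := hF hs
    have hlt : solScale k m a * s < ρ := by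
      have h2 := (hB hs).trans_lt haB
      rw [← div_eq_mul_inv, lt_div_iff₀ hσ0] at h2
      linarith
    have hpos : 0 < solScale k m a * s := mul_pos hσ0 hs0
    refine ⟨⟨hpos, hlt⟩, ?_⟩
    change U a (solScale k m a * s) - kHessianRupture N k m (solScale k m a * s) = 0
    rw [hU a ha ⟨hpos, hlt.trans hρ.2⟩]
    change a * u (solScale k m a * s / solScale k m a) - _ = 0
    rw [← kHessianRupture_scale hk hm ha.1 hpos.le,
      mul_div_cancel_left₀ s hσ0.ne', eq_mul_solRatio (u := u) hk hm hN hs0, hs1, mul_one,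
      kHessianRupture_eq]
    ring
  have h2 := encard_le_encard hsub
  rw [hinj.encard_image, encard_coe_eq_coe_finsetCard, hFn] at h2
  refine lt_of_lt_of_le ?_ h2
  exact_mod_cast Nat.lt_succ_self n

end Scaling

theorem proposition2p3 (N k : ℕ) (m : ℝ) (hk : 1 ≤ k)
    (hkm : (k : ℝ) < min m ((N : ℝ) / 2)) :
    ∃ r₀ : ℝ, 0 < r₀ ∧ ∃ ustar : ℝ → ℝ,
      -- existence, uniqueness and explicit form of the increasing rupture solution
      (IsRadialKHessianSol N k m r₀ 0 ustar ∧ StrictMonoOn ustar (Ico 0 r₀)) ∧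
      (∀ v : ℝ → ℝ, IsRadialKHessianSol N k m r₀ 0 v → StrictMonoOn v (Ico 0 r₀) →
        EqOn v ustar (Ico 0 r₀)) ∧
      (∀ r ∈ Ico 0 r₀, ustar r = kHessianRupture N k m r) ∧
      -- the regular solutions exist, and the increasing one is unique
      (∀ a ∈ Ioo (0 : ℝ) 1, ∃ u : ℝ → ℝ,
        (IsRadialKHessianSol N k m r₀ a u ∧ StrictMonoOn u (Ico 0 r₀)) ∧
        ∀ v : ℝ → ℝ, IsRadialKHessianSol N k m r₀ a v → StrictMonoOn v (Ico 0 r₀) →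
          EqOn v u (Ico 0 r₀)) ∧
      -- convergence of the regular solutions and divergence of the intersection number
      (∀ U : ℝ → ℝ → ℝ, (∀ a ∈ Ioo (0 : ℝ) 1, IsRadialKHessianSol N k m r₀ a (U a)) →
        (TendstoCLoc 2 (Ioo 0 r₀) U ustar ∧ TendstoCLoc 0 (Ico 0 r₀) U ustar) ∧
        (((m / (m - k) : ℝ) : EReal) < kHessianQc N k →
          ∀ ρ ∈ Ioo 0 r₀,
            Tendsto (fun a => zeroNumber (Ioo 0 ρ) (fun r => U a r - ustar r))
              (𝓝[>] 0) (𝓝 ⊤))) := by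
  have hm : (k : ℝ) < m := hkm.trans_le (min_le_left _ _)
  have hN : 2 * (k : ℝ) < N := by
    have := hkm.trans_le (min_le_right _ _)
    linarith
  have hk0 : (0 : ℝ) < k := by exact_mod_cast hk
  have hR : (0 : ℝ) < 2 * N := by linarith
  have hθ := ruptureExp_pos hk hm
  obtain ⟨V, V', hVc, hV0, hV⟩ := exists_radialFlow hk hm hN one_pos
  have hstar := radialFlow_kHessianRupture hk hm hN (2 * N)
  have hstar0 : kHessianRupture N k m 0 = 0 := by
    rw [kHessianRupture_eq, Real.zero_rpow hθ.ne', mul_zero]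
  have hstarc : ContinuousOn (kHessianRupture N k m) (Ico 0 (2 * N)) :=
    (continuous_const.mul (Real.continuous_rpow_const hθ.le)).continuousOn
  have hflow := fun (a : ℝ) (ha : a ∈ Ioo (0 : ℝ) 1) =>
    RadialFlow.scale_solScale hk hm hN hV ha.1 (2 * N)
  have hcont : ∀ a, ContinuousOn (fun r => a * V (r / solScale k m a)) (Ico 0 (2 * N)) :=
    fun a => (continuous_const.mul (hVc.comp (continuous_id.div_const _))).continuousOn
  have hzero : ∀ a, a * V (0 / solScale k m a) = a := fun a => by rw [zero_div, hV0, mul_one]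
  have huniq : ∀ a ∈ Ioo (0 : ℝ) 1, ∀ v, IsRadialKHessianSol N k m (2 * N) a v →
      EqOn v (fun r => a * V (r / solScale k m a)) (Ico 0 (2 * N)) := fun a ha v hv =>
    (hv.radialFlow hk hm hN ha.2).eqOn_of_pos hk hm hN ha.1 hv.continuousOn hv.value_zero
      (hflow a ha) (hcont a) (hzero a)
  -- On a ball of radius `2N` every solution with central value below `1` is increasing.
  refine ⟨2 * N, hR, kHessianRupture N k m,
    ⟨hstar.isRadialKHessianSol hk hN hstarc hstar0, hstar.strictMonoOn hstarc⟩, ?_,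
    fun _ _ => rfl, ?_, ?_⟩
  · intro v hv _ r hr
    rcases hr.1.eq_or_lt with rfl | hr0
    · rw [hv.value_zero, hstar0]
    · exact (hv.radialFlow hk hm hN one_pos).eqOn_kHessianRupture hk hm hN (hv.tendsto_nhds hR)
        ⟨hr0, hr.2⟩
  · intro a ha
    exact ⟨_, ⟨(hflow a ha).isRadialKHessianSol hk hN (hcont a) (hzero a),
      (hflow a ha).strictMonoOn (hcont a)⟩, fun v hv _ => huniq a ha v hv⟩
  · intro U hU
    have hUeq := fun a ha => huniq a ha (U a) (hU a ha)
    have hUeq' := fun a ha => (hUeq a ha).mono Ioo_subset_Ico_self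
    exact ⟨⟨tendstoCLoc_two_of_eqOn_scale hk hm hN hV hUeq',
      tendstoCLoc_zero_of_eqOn_scale hk hm hN hV hVc hUeq⟩, fun hq ρ hρ =>
      tendsto_zeroNumber hk hm hN hV (discriminant_neg_of_lt_qc hk hm hN hq) hUeq' hρ⟩
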